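/- All chains are chains in $\mathbb R^3$ with coefficients in $\mathbb Z/2$. Let $\mathbf P_k$ be the group of polyhedral $k$-chains ($\mathbf P_{-1}=0$) and $M(P)$ the mass ($k$-dimensional volume) of $P\in\mathbf P_k$. The group of flat $k$-chains is the completion of $\mathbf P_k$ in the flat norm $M_\flat(P)=\inf\{M(Q)+M(R): P=Q+\partial R,\ Q\in\mathbf P_k,\ R\in\mathbf P_{k+1}\}$, and the mass of a flat chain $B$ is the smallest possible value of $\liminf M(P_i)$ over sequences of polyhedral chains $P_i\to B$. For $k\ge 0$ let $\mathbf D_k$ be the group of $k$-dipolyhedra $D=\delta S+\mu T$, the direct sum of a copy $\delta\mathbf P_k$ of $\mathbf P_k$ (dipole chains) and a copy $\mu\mathbf P_{k-1}$ of $\mathbf P_{k-1}$ (mass chains), with boundary $\partial(\delta S+\mu T)=\delta(\partial S+T)-\mu(\partial T)$, energy $E(D)=M(S)+M(T)$ and support $|D|=|S|\cup|T|$. The group $\mathcal D_k$ of flat $k$-dipolyhedra is the completion of $\mathbf D_k$ in the norm $E_\flat(D)=\inf\{E(Q)+E(R): D=Q+\partial R,\ Q\in\mathbf D_k,\ R\in\mathbf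 D_{k+1}\}$. The maps $\delta,\mu$ extend by continuity to flat chains, every $A\in\mathcal D_k$ is $A=\delta B+\mu C$ for a unique flat $k$-chain $B$ and a unique flat $(k-1)$-chain $C$, and the energy $E(A)$ is the smallest possible value of $\liminf E(D_i)$ over sequences of dipolyhedra $D_i\to A$. For a flat chain $B$ with $M(B)<\infty$ let $\rho_B$ be the mass measure of $B$ (the measure $X\mapsto M(B\cap X)$), that is, the unique finite Borel measure on $\mathbb R^3$ such that for every sequence of polyhedral chains $P_i\to B$ with $M(P_i)\to M(B)$ and every Borel set $X$ with $\rho_B(\operatorname{fr}X)=0$ one has $M(P_i\cap X)\to\rho_B(X)$. For $A=\delta B+\mu C$ with $E(A)<\infty$ put $\nu_A=\rho_B+\rho_C$. The support $|\nu|$ of a Borel measure $\nu$ is the smallest closed set whose complement is $\nu$-null. A closed set $F$ supports $A\in\mathcal D_k$ if for every open $U\supset F$ there is a sequence of dipolyhedra $D_i\to A$ in $E_\flat$ with $|D_i|\subset U$ for all $i$. If there is a smallest closed set that supports $A$, it is called the support of $A$ and denoted $|A|$. Theorem. If $A\in\mathcal D_k$ and $E(A)<\infty$, then $\nu_A$ is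 well defined (it exists and is unique), $A$ has a support $|A|$, and $|A|=|\nu_A|$. -/

import Mathlib

open Filter Topology MeasureTheory UniformSpace
open scoped ENNReal

noncomputable section

namespace SoapFilm

/-- Euclidean three-space. -/
abbrev E3 : Type := EuclideanSpace ℝ (Fin 3)

/-! ### Group seminorms with values in `[0, ∞]` -/

/-- The pseudo-metric `N (x - y)` of a symmetric subadditive function `N` on a group. -/
abbrev edistOfSeminorm {G : Type*} [AddCommGroup G] (N : G → ℝ≥0∞) (h0 : N 0 = 0)
    (hneg : ∀ x, N (-x) = N x) (hadd : ∀ x y, N (x + y) ≤ N x + N y) :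
    PseudoEMetricSpace G where
  edist x y := N (x - y)
  edist_self x := by
    rw [sub_self, h0]
  edist_comm x y := by
    rw [← hneg, neg_sub]
  edist_triangle x y z := by
    have h := hadd (x - y) (y - z)
    rwa [sub_add_sub_cancel] at h

theorem isUniformAddGroup_of_edist {G : Type*} [AddCommGroup G] [PseudoEMetricSpace G]
    (N : G → ℝ≥0∞) (hneg : ∀ x, N (-x) = N x) (hadd : ∀ x y, N (x + y) ≤ N x + N y)
    (hd : ∀ x y : G, edist x y = N (x - y)) : IsUniformAddGroup G := by
  refine ⟨?_⟩
  rw [EMetric.uniformContinuous_iff]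
  intro ε hε
  refine ⟨ε / 2, ENNReal.half_pos hε.ne', ?_⟩
  rintro ⟨a, b⟩ ⟨c, d⟩ h
  have h' : max (edist a c) (edist b d) < ε / 2 := h
  rw [max_lt_iff] at h'
  obtain ⟨h1, h2⟩ := h'
  change edist (a - b) (c - d) < ε
  rw [hd] at h1 h2 ⊢
  have e : a - b - (c - d) = (a - c) + -(b - d) := by abel
  calc N (a - b - (c - d)) ≤ N (a - c) + N (-(b - d)) := by rw [e]; exact hadd _ _
    _ = N (a - c) + N (b - d) := by rw [hneg]
    _ < ε / 2 + ε / 2 := ENNReal.add_lt_add h1 h2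
    _ = ε := ENNReal.add_halves ε

/-! ### Polyhedral chains modulo two

Chains are indexed by the number `m` of vertices of their cells, so `PolyChain m` consists of the
polyhedral `(m - 1)`-chains, and there is no nonzero `(-1)`-chain. -/

/-- An affine simplex of dimension `m - 1` in three-space, given by its `m ≥ 1` vertices.
Degenerate simplices are allowed; they have mass zero. -/
structure Simplex (m : ℕ) where
  pos : 0 < m
  vertex : Fin m → E3

/-- The point set of a simplex. -/
def Simplex.carrier {m : ℕ} (σ : Simplex m) : Set E3 := convexHull ℝ (Set.range σ.vertex)

/-- The face opposite to the vertex with index `i`. -/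
def Simplex.face {m : ℕ} (hm : 0 < m) (σ : Simplex (m + 1)) (i : Fin (m + 1)) : Simplex m :=
  ⟨hm, fun j => σ.vertex (i.succAbove j)⟩

/-- Finite sums of `(m - 1)`-simplices with coefficients in `ℤ/2`. Two such sums represent the
same polyhedral chain if and only if their difference has mass zero; they are then identified
in the completion `FlatChain m`. -/
def PolyChain (m : ℕ) : Type := Simplex m →₀ ZMod 2

instance (m : ℕ) : AddCommGroup (PolyChain m) :=
  inferInstanceAs (AddCommGroup (Simplex m →₀ ZMod 2))

/-- The chain consisting of one simplex with coefficient `a`. -/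
def PolyChain.single {m : ℕ} (σ : Simplex m) : ZMod 2 →+ PolyChain m :=
  Finsupp.singleAddHom σ

/-- The boundary operator: the boundary of a simplex is the sum of its faces, and the boundary of
a `0`-simplex is `0`. -/
def PolyChain.boundary (m : ℕ) : PolyChain (m + 1) →+ PolyChain m :=
  Finsupp.liftAddHom fun σ =>
    if hm : 0 < m then ∑ i : Fin (m + 1), PolyChain.single (σ.face hm i) else 0

open Classical in
/-- The multiplicity modulo two at the point `x`: the sum of the coefficients of the
simplices that contain `x`. -/
def PolyChain.mult {m : ℕ} (x : E3) : PolyChain m →+ ZMod 2 :=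
  Finsupp.liftAddHom fun σ => if x ∈ σ.carrier then AddMonoidHom.id (ZMod 2) else 0

theorem PolyChain.boundary_single {m : ℕ} (σ : Simplex (m + 1)) (hm : 0 < m) (a : ZMod 2) :
    PolyChain.boundary m (PolyChain.single σ a) =
      ∑ i : Fin (m + 1), PolyChain.single (σ.face hm i) a := by
  refine (Finsupp.liftAddHom_apply_single _ σ a).trans ?_
  rw [dif_pos hm, AddMonoidHom.finsetSum_apply]

open Classical in
theorem PolyChain.mult_single {m : ℕ} (x : E3) (σ : Simplex m) (a : ZMod 2) :
    PolyChain.mult x (PolyChain.single σ a) = if x ∈ σ.carrier then a else 0 := by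
  refine (Finsupp.liftAddHom_apply_single _ σ a).trans ?_
  split_ifs <;> rfl

/-- The measure `ρ_P` of a polyhedral chain `P`: the `(m - 1)`-dimensional Hausdorff measure
(normalized so as to agree with Lebesgue measure on Euclidean space) restricted to
the points of odd multiplicity, so that `ρ_P X` is the mass of the part of `P` in `X`. -/
def PolyChain.measure {m : ℕ} (P : PolyChain m) : Measure E3 :=
  (μHE[m - 1] : Measure E3).restrict {x | PolyChain.mult x P ≠ 0}

/-- The mass of a polyhedral chain: the total volume of the cells of a representation by
nonoverlapping cells. -/
def PolyChain.mass {m : ℕ} (P : PolyChain m) : ℝ≥0∞ := P.measure Set.univ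

/-- The support of a polyhedral chain: the union of the cells of a representation by
nonoverlapping nondegenerate cells. -/
def PolyChain.support {m : ℕ} (P : PolyChain m) : Set E3 := P.measure.support

theorem PolyChain.mass_eq {m : ℕ} (P : PolyChain m) :
    P.mass = (μHE[m - 1] : Measure E3) {x | PolyChain.mult x P ≠ 0} := by
  simp [PolyChain.mass, PolyChain.measure]

theorem PolyChain.mass_zero {m : ℕ} : (0 : PolyChain m).mass = 0 := by
  simp [PolyChain.mass_eq]

theorem PolyChain.mass_neg {m : ℕ} (P : PolyChain m) : (-P).mass = P.mass := by
  simp only [PolyChain.mass_eq, map_neg, ne_eq, neg_eq_zero]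

theorem PolyChain.mass_add {m : ℕ} (P Q : PolyChain m) : (P + Q).mass ≤ P.mass + Q.mass := by
  simp only [PolyChain.mass_eq]
  refine (measure_mono ?_).trans (measure_union_le _ _)
  intro x hx
  by_contra h
  simp only [Set.mem_union, Set.mem_ofPred_eq, not_or, not_not] at h
  exact hx (by rw [map_add, h.1, h.2, add_zero])

/-! ### The flat norm and flat chains -/

/-- The flat norm `M_♭`. -/
def PolyChain.flatNorm {m : ℕ} (P : PolyChain m) : ℝ≥0∞ :=
  ⨅ (Q : PolyChain m) (R : PolyChain (m + 1)) (_ : P = Q + PolyChain.boundary m R),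
    Q.mass + R.mass

theorem PolyChain.flatNorm_le {m : ℕ} {P Q : PolyChain m} {R : PolyChain (m + 1)}
    (h : P = Q + PolyChain.boundary m R) : P.flatNorm ≤ Q.mass + R.mass :=
  iInf_le_of_le Q (iInf_le_of_le R (iInf_le_of_le h le_rfl))

theorem PolyChain.flatNorm_zero {m : ℕ} : (0 : PolyChain m).flatNorm = 0 := by
  have h := PolyChain.flatNorm_le (m := m) (P := 0) (Q := 0) (R := 0) (by simp)
  simpa [PolyChain.mass_zero] using h

theorem PolyChain.flatNorm_neg_le {m : ℕ} (P : PolyChain m) : (-P).flatNorm ≤ P.flatNorm := by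
  refine le_iInf fun Q => le_iInf fun R => le_iInf fun h => ?_
  have := PolyChain.flatNorm_le (m := m) (P := -P) (Q := -Q) (R := -R)
    (by rw [h, map_neg]; abel)
  rwa [PolyChain.mass_neg, PolyChain.mass_neg] at this

theorem PolyChain.flatNorm_neg {m : ℕ} (P : PolyChain m) : (-P).flatNorm = P.flatNorm :=
  le_antisymm P.flatNorm_neg_le (by simpa using (-P).flatNorm_neg_le)

theorem PolyChain.flatNorm_add {m : ℕ} (P P' : PolyChain m) :
    (P + P').flatNorm ≤ P.flatNorm + P'.flatNorm := by
  conv_rhs => rw [PolyChain.flatNorm, PolyChain.flatNorm]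
  simp only [ENNReal.iInf_add, ENNReal.add_iInf]
  refine le_iInf fun Q => le_iInf fun R => le_iInf fun h => le_iInf fun Q' => le_iInf fun R' =>
    le_iInf fun h' => ?_
  refine (PolyChain.flatNorm_le (Q := Q + Q') (R := R + R')
    (by rw [h, h', map_add]; abel)).trans ?_
  calc (Q + Q').mass + (R + R').mass
      ≤ (Q.mass + Q'.mass) + (R.mass + R'.mass) :=
        add_le_add (PolyChain.mass_add _ _) (PolyChain.mass_add _ _)
    _ = _ := by abel

instance (m : ℕ) : PseudoEMetricSpace (PolyChain m) :=
  edistOfSeminorm PolyChain.flatNorm PolyChain.flatNorm_zero PolyChain.flatNorm_neg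
    PolyChain.flatNorm_add

theorem PolyChain.edist_eq {m : ℕ} (P Q : PolyChain m) : edist P Q = (P - Q).flatNorm := rfl

instance (m : ℕ) : IsUniformAddGroup (PolyChain m) :=
  isUniformAddGroup_of_edist PolyChain.flatNorm PolyChain.flatNorm_neg PolyChain.flatNorm_add
    PolyChain.edist_eq

/-- The group of flat `(m - 1)`-chains modulo two: the completion of the polyhedral chains in
the flat norm. -/
abbrev FlatChain (m : ℕ) : Type := Completion (PolyChain m)

/-- The mass of a flat chain: the least lower limit of the masses of polyhedral chains
converging to it. -/
def flatMass {m : ℕ} (B : FlatChain m) : ℝ≥0∞ :=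
  ⨅ (P : ℕ → PolyChain m) (_ : Tendsto (fun i => (P i : FlatChain m)) atTop (𝓝 B)),
    liminf (fun i => (P i).mass) atTop

/-- `ρ` is the Borel measure `ρ_B` associated with the flat chain `B` of finite mass: the finite
Borel measure such that for all polyhedral `P_i → B` with `M(P_i) → M(B)` one has
`M(P_i ∩ X) → ρ X` for every Borel set `X` whose frontier is `ρ`-null. -/
structure IsMassMeasure {m : ℕ} (B : FlatChain m) (ρ : Measure E3) : Prop where
  finite : IsFiniteMeasure ρ
  tendsto : ∀ P : ℕ → PolyChain m,
    Tendsto (fun i => (P i : FlatChain m)) atTop (𝓝 B) →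
    Tendsto (fun i => (P i).mass) atTop (𝓝 (flatMass B)) →
    ∀ X : Set E3, MeasurableSet X → ρ (frontier X) = 0 →
      Tendsto (fun i => (P i).measure X) atTop (𝓝 (ρ X))

/-! ### Dipolyhedra -/

/-- The group of `k`-dipolyhedra: the direct sum of the dipole `k`-chains `δ S`, with `S` a
polyhedral `k`-chain, and the mass `k`-chains `μ T`, with `T` a polyhedral `(k - 1)`-chain. The
pair `(S, T)` stands for `δ S + μ T`. -/
def Dipolyhedron (k : ℕ) : Type := PolyChain (k + 1) × PolyChain k

instance (k : ℕ) : AddCommGroup (Dipolyhedron k) :=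
  inferInstanceAs (AddCommGroup (PolyChain (k + 1) × PolyChain k))

namespace Dipolyhedron

/-- The polyhedral `k`-chain `S` in `δ S + μ T`. -/
def dipolePart (k : ℕ) : Dipolyhedron k →+ PolyChain (k + 1) := AddMonoidHom.fst _ _

/-- The polyhedral `(k - 1)`-chain `T` in `δ S + μ T`. -/
def massPart (k : ℕ) : Dipolyhedron k →+ PolyChain k := AddMonoidHom.snd _ _

/-- The dipole chain `δ S` of a polyhedral chain `S`. -/
def dipole (k : ℕ) : PolyChain (k + 1) →+ Dipolyhedron k := AddMonoidHom.inl _ _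

/-- The mass chain `μ T` of a polyhedral chain `T`. -/
def massChain (k : ℕ) : PolyChain k →+ Dipolyhedron k := AddMonoidHom.inr _ _

/-- The boundary operator, determined by `∂ δ = δ ∂` and `δ = ∂ μ + μ ∂`, that is,
`∂ (δ S + μ T) = δ (∂ S + T) - μ (∂ T)`. -/
def boundary (k : ℕ) : Dipolyhedron (k + 1) →+ Dipolyhedron k :=
  (dipole k).comp ((PolyChain.boundary (k + 1)).comp (dipolePart (k + 1)) + massPart (k + 1)) -
    (massChain k).comp ((PolyChain.boundary k).comp (massPart (k + 1)))

variable {k : ℕ}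

theorem dipolePart_dipole (S : PolyChain (k + 1)) : dipolePart k (dipole k S) = S := rfl

theorem massPart_dipole (S : PolyChain (k + 1)) : massPart k (dipole k S) = 0 := rfl

theorem dipolePart_massChain (T : PolyChain k) : dipolePart k (massChain k T) = 0 := rfl

theorem massPart_massChain (T : PolyChain k) : massPart k (massChain k T) = T := rfl

theorem boundary_apply (D : Dipolyhedron (k + 1)) :
    boundary k D =
      dipole k (PolyChain.boundary (k + 1) (dipolePart (k + 1) D) + massPart (k + 1) D) -
        massChain k (PolyChain.boundary k (massPart (k + 1) D)) := rfl

/-- The energy `E (δ S + μ T)` is the weight `M S` of `δ S` plus the mass `M T` of `μ T`. -/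
def energy (D : Dipolyhedron k) : ℝ≥0∞ := (dipolePart k D).mass + (massPart k D).mass

/-- The support of a dipolyhedron `δ S + μ T` is the union of those of `S` and `T`. -/
def support (D : Dipolyhedron k) : Set E3 :=
  (dipolePart k D).support ∪ (massPart k D).support

theorem energy_zero : (0 : Dipolyhedron k).energy = 0 := by
  simp [energy, PolyChain.mass_zero]

theorem energy_neg (D : Dipolyhedron k) : (-D).energy = D.energy := by
  simp [energy, PolyChain.mass_neg]

theorem energy_add (D D' : Dipolyhedron k) : (D + D').energy ≤ D.energy + D'.energy := by
  simp only [energy, map_add]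
  refine (add_le_add (PolyChain.mass_add _ _) (PolyChain.mass_add _ _)).trans_eq ?_
  abel

/-- The norm `E_♭`. -/
def flatEnergy (D : Dipolyhedron k) : ℝ≥0∞ :=
  ⨅ (Q : Dipolyhedron k) (R : Dipolyhedron (k + 1)) (_ : D = Q + boundary k R),
    Q.energy + R.energy

theorem flatEnergy_le {D Q : Dipolyhedron k} {R : Dipolyhedron (k + 1)}
    (h : D = Q + boundary k R) : D.flatEnergy ≤ Q.energy + R.energy :=
  iInf_le_of_le Q (iInf_le_of_le R (iInf_le_of_le h le_rfl))

theorem flatEnergy_zero : (0 : Dipolyhedron k).flatEnergy = 0 := by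
  have h := flatEnergy_le (k := k) (D := 0) (Q := 0) (R := 0) (by simp)
  simpa [energy_zero] using h

theorem flatEnergy_neg_le (D : Dipolyhedron k) : (-D).flatEnergy ≤ D.flatEnergy := by
  refine le_iInf fun Q => le_iInf fun R => le_iInf fun h => ?_
  have := flatEnergy_le (k := k) (D := -D) (Q := -Q) (R := -R)
    (by rw [h, map_neg]; abel)
  rwa [energy_neg, energy_neg] at this

theorem flatEnergy_neg (D : Dipolyhedron k) : (-D).flatEnergy = D.flatEnergy :=
  le_antisymm D.flatEnergy_neg_le (by simpa using (-D).flatEnergy_neg_le)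

theorem flatEnergy_add (D D' : Dipolyhedron k) :
    (D + D').flatEnergy ≤ D.flatEnergy + D'.flatEnergy := by
  conv_rhs => rw [flatEnergy, flatEnergy]
  simp only [ENNReal.iInf_add, ENNReal.add_iInf]
  refine le_iInf fun Q => le_iInf fun R => le_iInf fun h => le_iInf fun Q' => le_iInf fun R' =>
    le_iInf fun h' => ?_
  refine (flatEnergy_le (Q := Q + Q') (R := R + R')
    (by rw [h, h', map_add]; abel)).trans ?_
  calc (Q + Q').energy + (R + R').energy
      ≤ (Q.energy + Q'.energy) + (R.energy + R'.energy) :=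
        add_le_add (energy_add _ _) (energy_add _ _)
    _ = _ := by abel

instance : PseudoEMetricSpace (Dipolyhedron k) :=
  edistOfSeminorm flatEnergy flatEnergy_zero flatEnergy_neg flatEnergy_add

theorem edist_eq (D D' : Dipolyhedron k) : edist D D' = (D - D').flatEnergy := rfl

instance : IsUniformAddGroup (Dipolyhedron k) :=
  isUniformAddGroup_of_edist flatEnergy flatEnergy_neg flatEnergy_add edist_eq

theorem flatEnergy_dipole_le (S : PolyChain (k + 1)) :
    (dipole k S).flatEnergy ≤ S.flatNorm := by
  refine le_iInf fun Q => le_iInf fun R => le_iInf fun h => ?_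
  have hb : boundary k (dipole (k + 1) R) = dipole k (PolyChain.boundary (k + 1) R) := by
    simp [boundary_apply, dipolePart_dipole, massPart_dipole]
  refine (flatEnergy_le (Q := dipole k Q) (R := dipole (k + 1) R)
    (by rw [hb, h, map_add])).trans_eq ?_
  simp [energy, dipolePart_dipole, massPart_dipole, PolyChain.mass_zero]

theorem flatEnergy_massChain_le (T : PolyChain k) :
    (massChain k T).flatEnergy ≤ 2 * T.flatNorm := by
  conv_rhs => rw [PolyChain.flatNorm]
  simp only [ENNReal.mul_iInf_of_ne (two_ne_zero) (ENNReal.ofNat_ne_top)]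
  refine le_iInf fun Q => le_iInf fun R => le_iInf fun h => ?_
  have hb : boundary k (massChain (k + 1) (-R)) =
      dipole k (-R) + massChain k (PolyChain.boundary k R) := by
    simp [boundary_apply, dipolePart_massChain, massPart_massChain]
  refine (flatEnergy_le (Q := dipole k R + massChain k Q) (R := massChain (k + 1) (-R))
    (by rw [hb, h, map_add, map_neg]; abel)).trans ?_
  have e1 : (dipole k R + massChain k Q).energy = R.mass + Q.mass := by
    simp [energy, dipolePart_dipole, massPart_dipole,
      dipolePart_massChain, massPart_massChain]
  have e2 : (massChain (k + 1) (-R)).energy = R.mass := by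
    simp [energy, dipolePart_massChain, massPart_massChain, PolyChain.mass_zero,
      PolyChain.mass_neg]
  rw [e1, e2, two_mul]
  calc R.mass + Q.mass + R.mass = Q.mass + R.mass + R.mass := by rw [add_comm R.mass]
    _ ≤ Q.mass + R.mass + (Q.mass + R.mass) := by gcongr; exact le_add_self

theorem continuous_dipole : Continuous (dipole k) := by
  have : LipschitzWith 1 (dipole k) := fun P Q => by
    rw [edist_eq, PolyChain.edist_eq, ← map_sub, ENNReal.coe_one, one_mul]
    exact flatEnergy_dipole_le _
  exact this.continuous

theorem continuous_massChain : Continuous (massChain k) := by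
  have : LipschitzWith 2 (massChain k) := fun P Q => by
    rw [edist_eq, PolyChain.edist_eq, ← map_sub]
    exact flatEnergy_massChain_le _
  exact this.continuous

end Dipolyhedron

/-- The group of flat `k`-dipolyhedra: the completion of the `k`-dipolyhedra in the norm `E_♭`. -/
abbrev FlatDipolyhedron (k : ℕ) : Type := Completion (Dipolyhedron k)

/-- The operator `δ` from flat `k`-chains to flat `k`-dipolyhedra, extended by continuity. -/
def delta (k : ℕ) : FlatChain (k + 1) →+ FlatDipolyhedron k :=
  (Dipolyhedron.dipole k).completion Dipolyhedron.continuous_dipole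

/-- The operator `μ` from flat `(k - 1)`-chains to flat `k`-dipolyhedra, extended by
continuity. -/
def mu (k : ℕ) : FlatChain k →+ FlatDipolyhedron k :=
  (Dipolyhedron.massChain k).completion Dipolyhedron.continuous_massChain

/-- The energy of a flat dipolyhedron: the least lower limit of the energies of dipolyhedra
converging to it. -/
def energy {k : ℕ} (A : FlatDipolyhedron k) : ℝ≥0∞ :=
  ⨅ (D : ℕ → Dipolyhedron k)
    (_ : Tendsto (fun i => (D i : FlatDipolyhedron k)) atTop (𝓝 A)),
    liminf (fun i => (D i).energy) atTop

/-- `ν` is the Borel measure `ν_A = ρ_B + ρ_C`, where `A = δ B + μ C`. -/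
def IsEnergyMeasure {k : ℕ} (A : FlatDipolyhedron k) (ν : Measure E3) : Prop :=
  ∃ (B : FlatChain (k + 1)) (C : FlatChain k) (ρB ρC : Measure E3),
    A = delta k B + mu k C ∧ IsMassMeasure B ρB ∧ IsMassMeasure C ρC ∧ ν = ρB + ρC

/-- The closed set `F` supports `A`: every open set containing `F` contains the supports of
the terms of some sequence of dipolyhedra tending to `A`. -/
def Supports {k : ℕ} (F : Set E3) (A : FlatDipolyhedron k) : Prop :=
  IsClosed F ∧ ∀ U : Set E3, IsOpen U → F ⊆ U → ∃ D : ℕ → Dipolyhedron k,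
    Tendsto (fun i => (D i : FlatDipolyhedron k)) atTop (𝓝 A) ∧ ∀ i, (D i).support ⊆ U

/-- `F` is the support `|A|`: the smallest closed set that supports `A`. -/
def IsSupport {k : ℕ} (F : Set E3) (A : FlatDipolyhedron k) : Prop :=
  IsLeast {F' : Set E3 | Supports F' A} F

end SoapFilm

end

/-!
A flat dipolyhedron is handled through its two components. If `D = Q + ∂R` for dipolyhedra, then the
dipole part and the mass part of `D` are decomposed accordingly, so both projections are
`1`-Lipschitz from `E_♭` to `M_♭` and extend to the completions, where they invert `δ + μ`. Hence
`A = δ B + μ C` uniquely, `B` and `C` have mass at most `E(A)`, and approximations of `A` and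
of the pair `(B, C)` correspond to each other. It remains to study a flat chain `B` of finite mass.

The geometric tool is the restriction of chains with control of the flat norm (`Separates`). A
simplex is cut by a hyperplane by bisecting, one at a time, the edges that cross it
(`exists_isHalfSpaceCut`), and the boundary of the cut `R'` of a chain `R` is the cut of its
boundary plus the slice of `R`. If `P = Q + ∂R` then, up to null sets, `P' = Q' + S + ∂R'` with
`S` the slice of `R`, and by the Eilenberg inequality (`exists_slice_le`) some hyperplane between
two given parallel ones has `M(S)` bounded by a multiple of `M(R)`. Intersections and unions
of half-spaces give restrictions to sets between a compact set and any neighborhood of it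
(`exists_separates_of_isCompact`).

The mass of flat chains is lower semicontinuous. So if `P i → B` with `M(P i) → M(B)`, and `P'` is
near `B` in the flat norm, then exchanging `P i` and `P'` in a set `W` between `K` and `U` cannot
lower the mass of `P i` noticeably. This is the comparison principle
(`IsMinimizing.exists_measure_le`): `M(P i ∩ K) ≤ M(P' ∩ U) + ε`, and the same
for complements. For complements of cubes it shows that the measures of a minimizing sequence are
tight; by Prokhorov's theorem they have weak limit points. For compact sets it shows that all
limit points, of all minimizing sequences, coincide (`IsMinimizing.le_of_tendsto`). Their common
value is the mass measure, and by the portmanteau theorem it has the defining property, which in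
turn determines it.

The support of the mass measure lies in every closed set that supports `B`: if chains that
avoid a neighborhood of `x` converge to `B`, then by the comparison principle a minimizing sequence
has little mass near `x` (`IsMassMeasure.notMem_support`). Conversely, given an open `U` around the
support of the mass measure, a compact subset of `U` carries almost all of the mass, and the
restriction of a late term of a minimizing sequence to a set near it differs little in mass, hence
in flat norm, from the whole term and has its support in `U`
(`IsMassMeasure.exists_tendsto_support_subset`).
-/

namespace SoapFilm

/-! ### Hausdorff measures of affine subspaces and of slices -/

/-- An affine subspace of dimension less than `d` is null for the `d`-dimensional measure. -/
theorem hausdorff_affineSubspace_eq_zero {d : ℕ} (G : AffineSubspace ℝ E3)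
    (hG : Module.finrank ℝ G.direction < d) : (μHE[d] : Measure E3) G = 0 := by
  have hH : (μH[d] : Measure E3) G = 0 := by
    rcases (G : Set E3).eq_empty_or_nonempty with h | ⟨p, hp⟩
    · simp [h]
    have hGe : (G : Set E3) = (fun v : G.direction => (v : E3) + p) '' Set.univ := by
      ext x
      simp only [Set.image_univ, Set.mem_range, Subtype.exists]
      constructor
      · intro hx
        exact ⟨x - p, AffineSubspace.vsub_mem_direction hx hp, by simp⟩
      · rintro ⟨v, hv, rfl⟩
        exact AffineSubspace.vadd_mem_of_mem_direction hv hp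
    have hi : Isometry (fun v : G.direction => (v : E3) + p) := by
      intro x y
      simp [Subtype.edist_eq]
    have hd : dimH (G : Set E3) < ((d : NNReal) : ℝ≥0∞) := by
      rw [hGe, hi.dimH_image, Real.dimH_univ_eq_finrank]
      exact_mod_cast hG
    simpa using hausdorffMeasure_of_dimH_lt hd
  rw [Measure.euclideanHausdorffMeasure_def, Measure.smul_apply, hH, smul_zero]

/-- Covers of a set of finite Hausdorff measure by nonempty sets of small diameter whose premeasure
is almost optimal. -/
theorem exists_cover_tsum_ediam_le {X : Type*} [EMetricSpace X] [MeasurableSpace X] [BorelSpace X]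
    {d : ℝ} {E : Set X} {r c : ℝ≥0∞} (hr : 0 < r) (hc : μH[d] E < c) :
    ∃ t : ℕ → Set X, E ⊆ ⋃ n, t n ∧ (∀ n, Metric.ediam (t n) ≤ r) ∧
      ∑' n, (⨆ _ : (t n).Nonempty, Metric.ediam (t n) ^ d) < c := by
  rw [Measure.hausdorffMeasure_apply] at hc
  have h := (le_iSup₂ (f := fun (r : ℝ≥0∞) (_ : 0 < r) =>
    ⨅ (t : ℕ → Set X) (_ : E ⊆ ⋃ n, t n) (_ : ∀ n, Metric.ediam (t n) ≤ r),
      ∑' n, ⨆ _ : (t n).Nonempty, Metric.ediam (t n) ^ d) r hr).trans_lt hc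
  simp only [iInf_lt_iff] at h
  obtain ⟨t, h1, h2, h3⟩ := h
  exact ⟨t, h1, h2, h3⟩

theorem tendsto_inv_nat_add_one : Tendsto (fun n : ℕ => ((n : ℝ≥0∞) + 1)⁻¹) atTop (𝓝 0) := by
  have := (tendsto_add_atTop_iff_nat 1).2 ENNReal.tendsto_inv_nat_nhds_zero
  simpa using this

/-- The Eilenberg inequality: the `(d + 1)`-dimensional measure of a set dominates the integral of
a measurable function that dominates the `d`-dimensional measures of its slices. -/
theorem exists_slice_bound (d : ℕ) {f : E3 → ℝ} (hf : LipschitzWith 1 f) (E : Set E3)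
    (hE : (μH[(d + 1 : ℕ)] : Measure E3) E ≠ ⊤) :
    ∃ g : ℝ → ℝ≥0∞, Measurable g ∧ (∀ t, (μH[d] : Measure E3) (E ∩ f ⁻¹' {t}) ≤ g t) ∧
      ∫⁻ t, g t ≤ (μH[(d + 1 : ℕ)] : Measure E3) E := by
  set M := (μH[(d + 1 : ℕ)] : Measure E3) E with hM
  have hr : ∀ n : ℕ, (0 : ℝ≥0∞) < ((n : ℝ≥0∞) + 1)⁻¹ := fun n => by
    simp [ENNReal.inv_pos]
  have hcov : ∀ n : ℕ, ∃ t : ℕ → Set E3, E ⊆ ⋃ i, t i ∧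
      (∀ i, Metric.ediam (t i) ≤ ((n : ℝ≥0∞) + 1)⁻¹) ∧
      ∑' i, (⨆ _ : (t i).Nonempty, Metric.ediam (t i) ^ ((d + 1 : ℕ) : ℝ)) <
        M + ((n : ℝ≥0∞) + 1)⁻¹ := fun n =>
    exists_cover_tsum_ediam_le (hr n) (ENNReal.lt_add_right hE (hr n).ne')
  choose t ht1 ht2 ht3 using hcov
  -- every slice of a covering set lies over a compact interval of the same diameter
  let I : ℕ → ℕ → Set ℝ := fun n i => closure (f '' t n i)
  have hIm : ∀ n i, MeasurableSet (I n i) := fun n i => isClosed_closure.measurableSet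
  have hIv : ∀ n i, volume (I n i) ≤ Metric.ediam (t n i) := fun n i => by
    refine (Real.volume_le_diam _).trans ?_
    rw [Metric.ediam_closure]
    simpa using hf.ediam_image_le (t n i)
  let g : ℕ → ℝ → ℝ≥0∞ := fun n s =>
    ∑' i, (I n i).indicator (fun _ => Metric.ediam (t n i) ^ (d : ℝ)) s
  have hgm : ∀ n, Measurable (g n) := fun n =>
    Measurable.tsum fun i => measurable_const.indicator (hIm n i)
  have hIe : ∀ n i s, s ∈ I n i → (t n i).Nonempty := fun n i s hs => by
    by_contra h
    rw [Set.not_nonempty_iff_eq_empty] at h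
    simp [I, h] at hs
  -- the covering sets over `s` cover the slice at `s`, so `g n s` bounds its premeasure
  refine ⟨fun s => liminf (fun n => g n s) atTop, .liminf hgm, fun s => ?_, ?_⟩
  · have h := Measure.hausdorffMeasure_le_liminf_tsum (X := E3) (β := ℕ)
      (ι := fun n => {i : ℕ // s ∈ I n i}) (d : ℝ) (E ∩ f ⁻¹' {s})
      (fun n : ℕ => ((n : ℝ≥0∞) + 1)⁻¹) tendsto_inv_nat_add_one (fun n i => t n i)
      (Eventually.of_forall fun n i => ht2 n i)
      (Eventually.of_forall fun n x hx => by
        obtain ⟨i, hi⟩ := Set.mem_iUnion.1 (ht1 n hx.1)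
        refine Set.mem_iUnion.2 ⟨⟨i, subset_closure ⟨x, hi, hx.2⟩⟩, hi⟩)
    refine h.trans_eq ?_
    congr 1
    ext n
    have := tsum_subtype {i : ℕ | s ∈ I n i}
      (fun i => Metric.ediam (t n i) ^ (d : ℝ))
    refine this.trans ?_
    refine tsum_congr fun i => ?_
    by_cases h : s ∈ I n i
    · rw [Set.indicator_of_mem (by exact h), Set.indicator_of_mem h]
    · rw [Set.indicator_of_notMem (by exact h), Set.indicator_of_notMem h]
  · refine (lintegral_liminf_le hgm).trans ?_
    have hb : ∀ n, ∫⁻ s, g n s ≤ M + ((n : ℝ≥0∞) + 1)⁻¹ := fun n => by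
      refine le_trans ?_ (ht3 n).le
      rw [lintegral_tsum fun i => (measurable_const.indicator (hIm n i)).aemeasurable]
      refine ENNReal.tsum_le_tsum fun i => ?_
      rw [lintegral_indicator_const (hIm n i)]
      by_cases hne : (t n i).Nonempty
      · rw [iSup_pos hne]
        refine (mul_le_mul_right (hIv n i) _).trans_eq ?_
        rw [ENNReal.rpow_natCast, ENNReal.rpow_natCast, pow_succ]
      · have : I n i = ∅ := Set.eq_empty_of_forall_notMem fun s hs => hne (hIe n i s hs)
        simp [this]
    refine (liminf_le_liminf (Eventually.of_forall hb)).trans_eq ?_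
    have : Tendsto (fun n : ℕ => M + ((n : ℝ≥0∞) + 1)⁻¹) atTop (𝓝 (M + 0)) :=
      tendsto_const_nhds.add tendsto_inv_nat_add_one
    rw [this.liminf_eq, add_zero]

/-- Among the slices of a set by the levels of a function in an interval, one outside any given
countable set of levels has measure at most a multiple of the measure of the set. -/
theorem exists_slice_le (d : ℕ) : ∃ C : NNReal, ∀ {f : E3 → ℝ}, LipschitzWith 1 f →
    ∀ (E : Set E3), (μHE[d + 1] : Measure E3) E ≠ ⊤ → ∀ {a b : ℝ}, a < b →
    ∀ N : Set ℝ, N.Countable → ∃ t ∈ Set.Ioo a b, t ∉ N ∧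
      (μHE[d] : Measure E3) (E ∩ f ⁻¹' {t}) ≤
        C / ENNReal.ofReal (b - a) * (μHE[d + 1] : Measure E3) E := by
  set c0 := Measure.addHaarScalarFactor (volume : Measure (EuclideanSpace ℝ (Fin d))) μH[d] with hc0
  set c1 := Measure.addHaarScalarFactor (volume : Measure (EuclideanSpace ℝ (Fin (d + 1))))
    μH[(d + 1 : ℕ)] with hc1
  have hc1' : c1 ≠ 0 := Measure.addHaarScalarFactor_volume_hausdorffMeasure_ne_zero (d + 1)
  refine ⟨c0 / c1, fun {f} hf E hE a b hab N hN => ?_⟩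
  have e0 : ∀ s, (μHE[d] : Measure E3) s = c0 * (μH[d] : Measure E3) s := fun s => by
    rw [Measure.euclideanHausdorffMeasure_def]; rfl
  have e1 : ∀ s, (μHE[d + 1] : Measure E3) s = c1 * (μH[(d + 1 : ℕ)] : Measure E3) s :=
    fun s => by rw [Measure.euclideanHausdorffMeasure_def]; rfl
  have hE' : (μH[(d + 1 : ℕ)] : Measure E3) E ≠ ⊤ := by
    intro h
    rw [e1, h] at hE
    exact hE (ENNReal.mul_top (by exact_mod_cast hc1'))
  obtain ⟨g, hg, h1, h2⟩ := exists_slice_bound d hf E hE'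
  have hv : volume (Set.Ioo a b) = ENNReal.ofReal (b - a) := Real.volume_Ioo
  have hpos : ENNReal.ofReal (b - a) ≠ 0 := by simpa using hab
  have hI : ∫⁻ s in Set.Ioo a b, g s ≠ ⊤ :=
    ((setLIntegral_le_lintegral _ _).trans h2).trans_lt hE'.lt_top |>.ne
  -- the bound for the slices is at most its average on a set of levels of positive measure
  have hex : ∃ t ∈ Set.Ioo a b, t ∉ N ∧ g t ≤ ⨍⁻ s in Set.Ioo a b, g s ∂volume := by
    have hp := measure_le_setLAverage_pos (μ := volume) (s := Set.Ioo a b) (f := g)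
      (by rw [hv]; exact hpos) (by rw [hv]; exact ENNReal.ofReal_ne_top)
      hg.aemeasurable
    have hN0 : volume N = 0 := hN.measure_zero _
    have : 0 < volume ({x | x ∈ Set.Ioo a b ∧ g x ≤ ⨍⁻ s in Set.Ioo a b, g s ∂volume} \ N) := by
      rw [measure_sdiff_null hN0]; exact hp
    obtain ⟨t, ⟨ht1, ht2⟩, ht3⟩ := nonempty_of_measure_ne_zero this.ne'
    exact ⟨t, ht1, ht3, ht2⟩
  obtain ⟨t, ht, htN, hgt⟩ := hex
  refine ⟨t, ht, htN, ?_⟩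
  rw [setLAverage_eq, hv] at hgt
  calc (μHE[d] : Measure E3) (E ∩ f ⁻¹' {t}) = c0 * (μH[d] : Measure E3) (E ∩ f ⁻¹' {t}) := e0 _
    _ ≤ c0 * ((μH[(d + 1 : ℕ)] : Measure E3) E / ENNReal.ofReal (b - a)) := by
        gcongr
        refine (h1 t).trans (hgt.trans ?_)
        gcongr
        exact (setLIntegral_le_lintegral _ _).trans h2
    _ = ((c0 / c1 : NNReal) : ℝ≥0∞) / ENNReal.ofReal (b - a) *
          (μHE[d + 1] : Measure E3) E := by
        have hc1e : (c1 : ℝ≥0∞) ≠ 0 := by exact_mod_cast hc1'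
        rw [e1, ENNReal.coe_div hc1', div_eq_mul_inv, div_eq_mul_inv, div_eq_mul_inv]
        calc _ = c0 * ((μH[(d + 1 : ℕ)] : Measure E3) E * (ENNReal.ofReal (b - a))⁻¹) *
              ((c1 : ℝ≥0∞)⁻¹ * c1) := by
                rw [ENNReal.inv_mul_cancel hc1e ENNReal.coe_ne_top, mul_one]
          _ = _ := by ring

/-! ### Bisecting simplices -/

theorem Fintype.sum_congr_off_pair {ι M : Type*} [Fintype ι] [DecidableEq ι] [AddCommMonoid M]
    {F F' : ι → M} {i j : ι} (hij : i ≠ j) (h : ∀ k, k ≠ i → k ≠ j → F k = F' k)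
    (h2 : F i + F j = F' i + F' j) : ∑ k, F k = ∑ k, F' k := by
  have key : ∀ G : ι → M, ∑ k, G k = G i + G j + ∑ k ∈ (Finset.univ.erase i).erase j, G k := by
    intro G
    rw [← Finset.add_sum_erase _ _ (Finset.mem_univ i), add_assoc,
      ← Finset.add_sum_erase _ _ (Finset.mem_erase.2 ⟨hij.symm, Finset.mem_univ j⟩)]
  rw [key F, key F', h2]
  congr 1
  refine Finset.sum_congr rfl fun k hk => ?_
  simp only [Finset.mem_erase] at hk
  exact h k hk.2.1 hk.1

theorem convexHull_update_subset {E ι : Type*} [AddCommGroup E] [Module ℝ E] [DecidableEq ι]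
    {v : ι → E} {i j : ι} {s : ℝ}
    (hs0 : 0 ≤ s) (hs1 : s ≤ 1) (k : ι) :
    convexHull ℝ (Set.range (Function.update v k (AffineMap.lineMap (v i) (v j) s))) ⊆
      convexHull ℝ (Set.range v) := by
  refine convexHull_min ?_ (convex_convexHull ℝ _)
  rintro _ ⟨l, rfl⟩
  by_cases h : l = k
  · subst h
    rw [Function.update_self]
    exact (convex_convexHull ℝ _).lineMap_mem (subset_convexHull ℝ _ (Set.mem_range_self i))
      (subset_convexHull ℝ _ (Set.mem_range_self j)) ⟨hs0, hs1⟩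
  · rw [Function.update_of_ne h]
    exact subset_convexHull ℝ _ ⟨l, rfl⟩

section Hull

variable {E : Type*} [AddCommGroup E] [Module ℝ E] {ι : Type*} [Fintype ι]

theorem mem_convexHull_range_iff {v : ι → E} {x : E} :
    x ∈ convexHull ℝ (Set.range v) ↔
      ∃ w : ι → ℝ, (∀ i, 0 ≤ w i) ∧ ∑ i, w i = 1 ∧ ∑ i, w i • v i = x := by
  classical
  constructor
  · intro hx
    have hsub : convexHull ℝ (Set.range v) ⊆
        Fintype.linearCombination ℝ v '' stdSimplex ℝ ι := by
      refine convexHull_min ?_ ((convex_stdSimplex ℝ ι).linear_image _)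
      rintro _ ⟨i, rfl⟩
      exact ⟨Pi.single i 1, single_mem_stdSimplex ℝ i, by
        simp [Fintype.linearCombination_apply, Pi.single_apply, ite_smul]⟩
    obtain ⟨w, hw, rfl⟩ := hsub hx
    exact ⟨w, hw.1, hw.2, by simp [Fintype.linearCombination_apply]⟩
  · rintro ⟨w, h0, h1, h2⟩
    exact mem_convexHull_of_exists_fintype w v h0 h1 (fun i => ⟨i, rfl⟩) h2

/-- A point of a simplex whose barycentric coordinate at a vertex vanishes lies in the opposite
face. -/
theorem mem_convexHull_face {n : ℕ} {v : Fin (n + 1) → E} {i : Fin (n + 1)} {w : Fin (n + 1) → ℝ}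
    {x : E} (h0 : ∀ k, 0 ≤ w k) (h1 : ∑ k, w k = 1) (hx : ∑ k, w k • v k = x) (hi : w i = 0) :
    x ∈ convexHull ℝ (Set.range (v ∘ i.succAbove)) := by
  rw [mem_convexHull_range_iff]
  rw [Fin.sum_univ_succAbove _ i, hi] at h1
  rw [Fin.sum_univ_succAbove _ i, hi] at hx
  exact ⟨fun k => w (i.succAbove k), fun k => h0 _, by simpa using h1, by simpa using hx⟩

variable [DecidableEq ι]

/-- Bisecting a simplex at an interior point `p` of the edge from `v i` to `v j` produces two
simplices that cover it, in which `p` replaces `v j` and `v i` respectively. -/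
theorem convexHull_bisect {v : ι → E} {i j : ι} (hij : i ≠ j) {s : ℝ} (hs : s ∈ Set.Ioo (0 : ℝ) 1) :
    convexHull ℝ (Set.range v) =
      convexHull ℝ (Set.range (Function.update v j (AffineMap.lineMap (v i) (v j) s))) ∪
      convexHull ℝ (Set.range (Function.update v i (AffineMap.lineMap (v i) (v j) s))) := by
  obtain ⟨hs0, hs1⟩ := hs
  have hs1' : 0 < 1 - s := by linarith
  refine Set.Subset.antisymm ?_ (Set.union_subset
    (convexHull_update_subset hs0.le hs1.le j) (convexHull_update_subset hs0.le hs1.le i))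
  intro x hx
  obtain ⟨w, h0, h1, rfl⟩ := mem_convexHull_range_iff.1 hx
  -- the ratio of the coordinates at the ends of the edge decides in which half the point lies
  rcases le_total (w j * (1 - s)) (w i * s) with hc | hc
  · left
    obtain ⟨a, ha⟩ : ∃ a, w j = a * s := ⟨w j / s, by field_simp⟩
    have ha0 : 0 ≤ a := by have := h0 j; rw [ha] at this; exact nonneg_of_mul_nonneg_left this hs0
    rw [mem_convexHull_range_iff]
    refine ⟨fun k => if k = i then w i - a * (1 - s) else if k = j then a else w k,
      fun k => ?_, ?_, ?_⟩
    · dsimp only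
      split_ifs
      · rw [ha] at hc
        refine sub_nonneg.2 (le_of_mul_le_mul_right ?_ hs0)
        linarith
      · exact ha0
      · exact h0 k
    · refine (Fintype.sum_congr_off_pair hij (fun k hi hj => by simp [hi, hj]) ?_).trans h1
      simp only [if_true, if_neg hij.symm, ha]
      ring
    · refine Fintype.sum_congr_off_pair hij (fun k hi hj => by simp [hi, hj]) ?_
      simp only [if_true, if_neg hij.symm, Function.update_self, Function.update_of_ne hij,
        AffineMap.lineMap_apply_module, ha]
      module
  · right
    obtain ⟨a, ha⟩ : ∃ a, w i = a * (1 - s) := ⟨w i / (1 - s), by field_simp⟩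
    have ha0 : 0 ≤ a := by have := h0 i; rw [ha] at this; exact nonneg_of_mul_nonneg_left this hs1'
    rw [mem_convexHull_range_iff]
    refine ⟨fun k => if k = i then a else if k = j then w j - a * s else w k,
      fun k => ?_, ?_, ?_⟩
    · dsimp only
      split_ifs
      · exact ha0
      · rw [ha] at hc
        refine sub_nonneg.2 (le_of_mul_le_mul_right ?_ hs1')
        linarith
      · exact h0 k
    · refine (Fintype.sum_congr_off_pair hij (fun k hi hj => by simp [hi, hj]) ?_).trans h1
      simp only [if_true, if_neg hij.symm, ha]
      ring
    · refine Fintype.sum_congr_off_pair hij (fun k hi hj => by simp [hi, hj]) ?_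
      simp only [if_true, if_neg hij.symm, Function.update_self, Function.update_of_ne hij.symm,
        AffineMap.lineMap_apply_module, ha]
      module

/-- The two halves of a bisected nondegenerate simplex meet in a common face. -/
theorem convexHull_bisect_inter {n : ℕ} {v : Fin (n + 1) → E} (hv : AffineIndependent ℝ v)
    {i j : Fin (n + 1)} (hij : i ≠ j) {s : ℝ} (hs : s ∈ Set.Ioo (0 : ℝ) 1) :
    convexHull ℝ (Set.range (Function.update v j (AffineMap.lineMap (v i) (v j) s))) ∩
      convexHull ℝ (Set.range (Function.update v i (AffineMap.lineMap (v i) (v j) s))) ⊆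
    convexHull ℝ (Set.range
      (Function.update v j (AffineMap.lineMap (v i) (v j) s) ∘ i.succAbove)) := by
  obtain ⟨hs0, hs1⟩ := hs
  have hs1' : 0 < 1 - s := by linarith
  rintro x ⟨hx1, hx2⟩
  obtain ⟨u, u0, u1, hu⟩ := mem_convexHull_range_iff.1 hx1
  obtain ⟨w, w0, w1, hw⟩ := mem_convexHull_range_iff.1 hx2
  refine mem_convexHull_face u0 u1 hu ?_
  -- compare the barycentric coordinates with respect to the undivided simplex
  let u' : Fin (n + 1) → ℝ := fun k =>
    if k = i then u i + u j * (1 - s) else if k = j then u j * s else u k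
  let w' : Fin (n + 1) → ℝ := fun k =>
    if k = i then w i * (1 - s) else if k = j then w j + w i * s else w k
  have hu1 : ∑ k, u' k = 1 := by
    refine (Fintype.sum_congr_off_pair hij (fun k hi hj => by simp [u', hi, hj]) ?_).trans u1
    simp only [u', if_true, if_neg hij.symm]
    ring
  have hw1 : ∑ k, w' k = 1 := by
    refine (Fintype.sum_congr_off_pair hij (fun k hi hj => by simp [w', hi, hj]) ?_).trans w1
    simp only [w', if_true, if_neg hij.symm]
    ring
  have hux : ∑ k, u' k • v k = x := by
    rw [← hu]
    refine Fintype.sum_congr_off_pair hij (fun k hi hj => by simp [u', hi, hj]) ?_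
    simp only [u', if_true, if_neg hij.symm, Function.update_self, Function.update_of_ne hij,
      AffineMap.lineMap_apply_module]
    module
  have hwx : ∑ k, w' k • v k = x := by
    rw [← hw]
    refine Fintype.sum_congr_off_pair hij (fun k hi hj => by simp [w', hi, hj]) ?_
    simp only [w', if_true, if_neg hij.symm, Function.update_self, Function.update_of_ne hij.symm,
      AffineMap.lineMap_apply_module]
    module
  have huw : u' = w' := by
    rw [affineIndependent_iff] at hv
    funext k
    have := hv Finset.univ (u' - w') (by simp [hu1, hw1])
      (by simp [sub_smul, hux, hwx]) k (Finset.mem_univ k)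
    simpa [sub_eq_zero] using this
  have e1 : u i + u j * (1 - s) = w i * (1 - s) := by simpa [u', w'] using congrFun huw i
  have e2 : u j * s = w j + w i * s := by
    have := congrFun huw j
    simpa [u', w', hij.symm] using this
  have hi := u0 i
  have hj := w0 j
  nlinarith [mul_nonneg hi hs0.le, mul_nonneg hj hs1'.le]

end Hull

theorem finrank_direction_affineSpan_range_le {n : ℕ} (v : Fin (n + 1) → E3) :
    Module.finrank ℝ (affineSpan ℝ (Set.range v)).direction ≤ n := by
  rw [direction_affineSpan]
  exact finrank_vectorSpan_range_le ℝ v (by simp)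

/-- The overlap of the two halves of a bisected simplex lies in an affine subspace of lower
dimension, which contains the vertices not on the bisected edge. -/
theorem exists_affineSubspace_bisect_inter {n : ℕ} (v : Fin (n + 1) → E3)
    {i j : Fin (n + 1)} (hij : i ≠ j) {s : ℝ} (hs : s ∈ Set.Ioo (0 : ℝ) 1) :
    ∃ G : AffineSubspace ℝ E3, Module.finrank ℝ G.direction < n ∧
      convexHull ℝ (Set.range (Function.update v j (AffineMap.lineMap (v i) (v j) s))) ∩
        convexHull ℝ (Set.range (Function.update v i (AffineMap.lineMap (v i) (v j) s))) ⊆ G ∧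
      ∀ k, k ≠ i → k ≠ j → v k ∈ G := by
  by_cases hv : AffineIndependent ℝ v
  · obtain ⟨m, rfl⟩ : ∃ m, n = m + 1 := Nat.exists_eq_succ_of_ne_zero (by
      rintro rfl
      exact hij (Fin.ext (by omega)))
    refine ⟨affineSpan ℝ (Set.range
      (Function.update v j (AffineMap.lineMap (v i) (v j) s) ∘ i.succAbove)),
      Nat.lt_succ_of_le (finrank_direction_affineSpan_range_le _),
      (convexHull_bisect_inter hv hij hs).trans (convexHull_subset_affineSpan _),
      fun k hki hkj => ?_⟩
    obtain ⟨l, rfl⟩ := Fin.exists_succAbove_eq hki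
    refine subset_affineSpan _ _ ⟨l, ?_⟩
    simp [Function.update_of_ne hkj]
  · refine ⟨affineSpan ℝ (Set.range v), ?_, ?_, fun k _ _ => subset_affineSpan _ _ ⟨k, rfl⟩⟩
    · have h1 := finrank_direction_affineSpan_range_le v
      refine lt_of_le_of_ne h1 fun h => hv ?_
      rw [affineIndependent_iff_finrank_vectorSpan_eq ℝ v (n := n) (by simp),
        ← direction_affineSpan, h]
    · exact Set.inter_subset_left.trans ((convexHull_update_subset hs.1.le hs.2.le j).trans
        (convexHull_subset_affineSpan _))

/-- A hyperplane meets an affine subspace of dimension at most `d` that it does not contain in a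
null set for the `d`-dimensional measure. -/
theorem hausdorff_affineSubspace_inter_hyperplane {d : ℕ} (f : E3 →L[ℝ] ℝ) (t : ℝ)
    (G : AffineSubspace ℝ E3) (hG : Module.finrank ℝ G.direction ≤ d) {c : E3} (hc : c ∈ G)
    (hct : f c ≠ t) : (μHE[d] : Measure E3) (G ∩ {x | f x = t}) = 0 := by
  let H : AffineSubspace ℝ E3 :=
    AffineSubspace.comap f.toLinearMap.toAffineMap (affineSpan ℝ {t})
  have hmem : ∀ x, x ∈ H ↔ f x = t := fun x => by simp [H]
  have hset : (G : Set E3) ∩ {x | f x = t} = ((G ⊓ H : AffineSubspace ℝ E3) : Set E3) := by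
    ext x
    exact (and_congr_right fun _ => (hmem x).symm).trans (AffineSubspace.mem_inf_iff _ _ _).symm
  rw [hset]
  rcases ((G ⊓ H : AffineSubspace ℝ E3) : Set E3).eq_empty_or_nonempty with h | h
  · rw [h, measure_empty]
  have hlt : G ⊓ H < G := by
    refine lt_of_le_of_ne inf_le_left fun h => hct ?_
    rw [← h] at hc
    exact (hmem c).1 ((AffineSubspace.mem_inf_iff _ _ _).1 hc).2
  exact hausdorff_affineSubspace_eq_zero _ ((Submodule.finrank_lt_finrank_of_lt
    (AffineSubspace.direction_lt_of_nonempty hlt h)).trans_le hG)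

theorem hausdorff_convexHull_inter_hyperplane {n : ℕ} (f : E3 →L[ℝ] ℝ) (t : ℝ)
    (v : Fin (n + 1) → E3) {k : Fin (n + 1)} (hk : f (v k) ≠ t) :
    (μHE[n] : Measure E3) (convexHull ℝ (Set.range v) ∩ {x | f x = t}) = 0 :=
  measure_mono_null (Set.inter_subset_inter_left _ (convexHull_subset_affineSpan _))
    (hausdorff_affineSubspace_inter_hyperplane f t _ (finrank_direction_affineSpan_range_le v)
      (subset_affineSpan _ _ ⟨k, rfl⟩) hk)

theorem le_of_mem_convexHull_range {ι : Type*} (f : E3 →L[ℝ] ℝ) {t : ℝ} {v : ι → E3}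
    (h : ∀ k, f (v k) ≤ t) {x : E3} (hx : x ∈ convexHull ℝ (Set.range v)) : f x ≤ t := by
  have : convexHull ℝ (Set.range v) ⊆ {x | f x ≤ t} :=
    convexHull_min (by rintro _ ⟨k, rfl⟩; exact h k) (convex_halfSpace_le f.isLinear t)
  exact this hx

/-- A simplex on one side of a hyperplane meets it inside the face opposite to any vertex off the
hyperplane. -/
theorem mem_convexHull_face_of_eq {n : ℕ} (f : E3 →L[ℝ] ℝ) {t : ℝ} {v : Fin (n + 1) → E3}
    (h : ∀ k, f (v k) ≤ t) {i : Fin (n + 1)} (hi : f (v i) < t) {x : E3}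
    (hx : x ∈ convexHull ℝ (Set.range v)) (hxt : f x = t) :
    x ∈ convexHull ℝ (Set.range (v ∘ i.succAbove)) := by
  obtain ⟨w, w0, w1, rfl⟩ := mem_convexHull_range_iff.1 hx
  refine mem_convexHull_face w0 w1 rfl ?_
  have h0 : ∑ k, w k * (t - f (v k)) = 0 := by
    have e : ∑ k, w k * f (v k) = t := by simpa using hxt
    simp only [mul_sub, Finset.sum_sub_distrib, ← Finset.sum_mul, w1, e]
    ring
  have := (Finset.sum_eq_zero_iff_of_nonneg (fun k _ =>
    mul_nonneg (w0 k) (sub_nonneg.2 (h k)))).1 h0 i (Finset.mem_univ i)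
  rcases mul_eq_zero.1 this with h | h
  · exact h
  · linarith

/-! ### Cutting chains by hyperplanes -/

/-- The simplex with the given vertices. -/
abbrev simplexOf {n : ℕ} (v : Fin (n + 1) → E3) : Simplex (n + 1) := ⟨n.succ_pos, v⟩

open Classical in
/-- The indicator function modulo two of the simplex with the given vertices. -/
noncomputable def hullInd {n : ℕ} (v : Fin (n + 1) → E3) (x : E3) : ZMod 2 :=
  if x ∈ convexHull ℝ (Set.range v) then 1 else 0

theorem hullInd_of_mem {n : ℕ} {v : Fin (n + 1) → E3} {x : E3}
    (h : x ∈ convexHull ℝ (Set.range v)) : hullInd v x = 1 := if_pos h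

theorem hullInd_of_notMem {n : ℕ} {v : Fin (n + 1) → E3} {x : E3}
    (h : x ∉ convexHull ℝ (Set.range v)) : hullInd v x = 0 := if_neg h

theorem mult_simplexOf {n : ℕ} (v : Fin (n + 1) → E3) (x : E3) :
    PolyChain.mult x (PolyChain.single (simplexOf v) 1) = hullInd v x :=
  PolyChain.mult_single x _ 1

theorem mult_boundary_simplexOf {n : ℕ} (v : Fin (n + 2) → E3) (x : E3) :
    PolyChain.mult x (PolyChain.boundary (n + 1) (PolyChain.single (simplexOf v) 1)) =
      ∑ k : Fin (n + 2), hullInd (v ∘ k.succAbove) x := by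
  rw [PolyChain.boundary_single _ n.succ_pos, map_sum]
  exact Finset.sum_congr rfl fun k _ => PolyChain.mult_single x _ 1

theorem boundary_zero_apply (P : PolyChain 1) : PolyChain.boundary 0 P = 0 := by
  have : IsEmpty (Simplex 0) := ⟨fun σ => lt_irrefl _ σ.pos⟩
  exact Finsupp.ext fun σ => isEmptyElim σ

theorem hullInd_bisect {n : ℕ} (v : Fin (n + 1) → E3) {i j : Fin (n + 1)} (hij : i ≠ j) {s : ℝ}
    (hs : s ∈ Set.Ioo (0 : ℝ) 1) {x : E3}
    (hx : x ∉ convexHull ℝ (Set.range (Function.update v j (AffineMap.lineMap (v i) (v j) s))) ∩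
      convexHull ℝ (Set.range (Function.update v i (AffineMap.lineMap (v i) (v j) s)))) :
    hullInd v x = hullInd (Function.update v j (AffineMap.lineMap (v i) (v j) s)) x +
      hullInd (Function.update v i (AffineMap.lineMap (v i) (v j) s)) x := by
  have hu := convexHull_bisect (v := v) hij hs
  unfold hullInd
  rw [hu]
  by_cases h1 : x ∈ convexHull ℝ (Set.range (Function.update v j (AffineMap.lineMap (v i) (v j) s)))
  <;> by_cases h2 :
    x ∈ convexHull ℝ (Set.range (Function.update v i (AffineMap.lineMap (v i) (v j) s)))
  · exact absurd ⟨h1, h2⟩ hx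
  all_goals simp [h1, h2]

theorem ae_hullInd_bisect {n : ℕ} (v : Fin (n + 1) → E3) {i j : Fin (n + 1)} (hij : i ≠ j) {s : ℝ}
    (hs : s ∈ Set.Ioo (0 : ℝ) 1) :
    ∀ᵐ x ∂(μHE[n] : Measure E3),
      hullInd v x = hullInd (Function.update v j (AffineMap.lineMap (v i) (v j) s)) x +
        hullInd (Function.update v i (AffineMap.lineMap (v i) (v j) s)) x := by
  obtain ⟨G, hG, hsub, -⟩ := exists_affineSubspace_bisect_inter v hij hs
  have h0 : ∀ᵐ x ∂(μHE[n] : Measure E3), x ∉ (G : Set E3) :=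
    measure_eq_zero_iff_ae_notMem.1 (hausdorff_affineSubspace_eq_zero G hG)
  filter_upwards [h0] with x hx
  exact hullInd_bisect v hij hs fun h => hx (hsub h)

/-- The boundary of a simplex is the sum of the boundaries of the halves of a bisection: the
faces containing the bisected edge are bisected, and the new face is counted twice. -/
theorem ae_sum_hullInd_bisect {n : ℕ} (v : Fin (n + 2) → E3) {i j : Fin (n + 2)} (hij : i ≠ j)
    {s : ℝ} (hs : s ∈ Set.Ioo (0 : ℝ) 1) :
    ∀ᵐ x ∂(μHE[n] : Measure E3),
      ∑ k : Fin (n + 2), hullInd (v ∘ k.succAbove) x =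
        ∑ k : Fin (n + 2), hullInd
          (Function.update v j (AffineMap.lineMap (v i) (v j) s) ∘ k.succAbove) x +
        ∑ k : Fin (n + 2), hullInd
          (Function.update v i (AffineMap.lineMap (v i) (v j) s) ∘ k.succAbove) x := by
  set p := AffineMap.lineMap (v i) (v j) s with hp
  -- the face opposite to a vertex off the edge is itself bisected
  have hface : ∀ k : Fin (n + 2), k ≠ i → k ≠ j → ∀ᵐ x ∂(μHE[n] : Measure E3),
      hullInd (v ∘ k.succAbove) x = hullInd (Function.update v j p ∘ k.succAbove) x +
        hullInd (Function.update v i p ∘ k.succAbove) x := by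
    intro k hi hj
    obtain ⟨i', rfl⟩ := Fin.exists_succAbove_eq hi.symm
    obtain ⟨j', rfl⟩ := Fin.exists_succAbove_eq hj.symm
    have hij' : i' ≠ j' := fun h => hij (by rw [h])
    rw [Function.update_comp_eq_of_injective _ Fin.succAbove_right_injective,
      Function.update_comp_eq_of_injective _ Fin.succAbove_right_injective]
    exact ae_hullInd_bisect (v ∘ k.succAbove) hij' hs
  have hall : ∀ᵐ x ∂(μHE[n] : Measure E3), ∀ k : Fin (n + 2), k ≠ i → k ≠ j →
      hullInd (v ∘ k.succAbove) x = hullInd (Function.update v j p ∘ k.succAbove) x +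
        hullInd (Function.update v i p ∘ k.succAbove) x := by
    rw [ae_all_iff]
    intro k
    by_cases hi : k = i
    · exact Eventually.of_forall fun x h => absurd hi h
    by_cases hj : k = j
    · exact Eventually.of_forall fun x _ h => absurd hj h
    filter_upwards [hface k hi hj] with x hx _ _ using hx
  have hcomp : ∀ (k : Fin (n + 2)), Function.update v k p ∘ k.succAbove = v ∘ k.succAbove := by
    intro k
    funext l
    simp
  -- the two halves share the new face, whose two copies cancel
  have hrange : Set.range (Function.update v j p ∘ i.succAbove) =
      Set.range (Function.update v i p ∘ j.succAbove) := by
    rw [Set.range_comp, Set.range_comp, Fin.range_succAbove, Fin.range_succAbove]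
    ext y
    simp only [Set.mem_image, Set.mem_compl_iff, Set.mem_singleton_iff]
    constructor
    · rintro ⟨k, hk, rfl⟩
      by_cases hkj : k = j
      · exact ⟨i, hij, by rw [hkj, Function.update_self, Function.update_self]⟩
      · exact ⟨k, hkj, by rw [Function.update_of_ne hk, Function.update_of_ne hkj]⟩
    · rintro ⟨k, hk, rfl⟩
      by_cases hki : k = i
      · exact ⟨j, hij.symm, by rw [hki, Function.update_self, Function.update_self]⟩
      · exact ⟨k, hki, by rw [Function.update_of_ne hk, Function.update_of_ne hki]⟩
  filter_upwards [hall] with x hx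
  rw [← Finset.sum_add_distrib]
  refine Fintype.sum_congr_off_pair hij hx ?_
  rw [hcomp i, hcomp j]
  have e : hullInd (Function.update v j p ∘ i.succAbove) x =
      hullInd (Function.update v i p ∘ j.succAbove) x := by
    unfold hullInd
    rw [hrange]
  rw [e]
  have h2 := CharTwo.add_self_eq_zero (hullInd (Function.update v i p ∘ j.succAbove) x)
  linear_combination -h2

/-- The chain `Q` is the part of the chain `P` in the half-space `{f < t}`, and its boundary
consists of the part of the boundary of `P` in that half-space and the slice of `P` by the
hyperplane `{f = t}`. -/
structure IsHalfSpaceCut (f : E3 →L[ℝ] ℝ) (t : ℝ) {m : ℕ} (P Q : PolyChain (m + 1)) : Prop where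
  mult_eq : ∀ᵐ x ∂(μHE[m] : Measure E3),
    PolyChain.mult x Q = if f x < t then PolyChain.mult x P else 0
  mult_boundary_eq : ∀ᵐ x ∂(μHE[m - 1] : Measure E3),
    PolyChain.mult x (PolyChain.boundary m Q) =
      (if f x < t then PolyChain.mult x (PolyChain.boundary m P) else 0) +
        if f x = t then PolyChain.mult x P else 0

theorem IsHalfSpaceCut.add {f : E3 →L[ℝ] ℝ} {t : ℝ} {m : ℕ} {P P' Q Q' : PolyChain (m + 1)}
    (h : IsHalfSpaceCut f t P Q) (h' : IsHalfSpaceCut f t P' Q') :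
    IsHalfSpaceCut f t (P + P') (Q + Q') := by
  constructor
  · filter_upwards [h.mult_eq, h'.mult_eq] with x h1 h2
    rw [map_add, map_add, h1, h2]
    split_ifs <;> simp
  · filter_upwards [h.mult_boundary_eq, h'.mult_boundary_eq] with x h1 h2
    simp only [map_add, h1, h2]
    split_ifs <;> abel

/-- A simplex that lies on one side of the hyperplane, and not inside it, is its own cut: it has
at most one face in the hyperplane, and this face is its slice. -/
theorem isHalfSpaceCut_self (f : E3 →L[ℝ] ℝ) (t : ℝ) {n : ℕ} (v : Fin (n + 1) → E3)
    (h : ∀ k, f (v k) ≤ t) {i : Fin (n + 1)} (hi : f (v i) < t) :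
    IsHalfSpaceCut f t (PolyChain.single (simplexOf v) 1)
      (PolyChain.single (simplexOf v) 1) := by
  constructor
  · have h0 := measure_eq_zero_iff_ae_notMem.1
      (hausdorff_convexHull_inter_hyperplane f t v (k := i) hi.ne)
    filter_upwards [h0] with x hx
    rw [mult_simplexOf]
    split_ifs with hlt
    · rfl
    · refine hullInd_of_notMem fun hm => hx ⟨hm, ?_⟩
      exact le_antisymm (le_of_mem_convexHull_range f h hm) (not_lt.1 hlt)
  · cases n with
    | zero =>
      refine Eventually.of_forall fun x => ?_
      simp only [boundary_zero_apply, map_zero, mult_simplexOf, ite_self, zero_add]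
      split_ifs with hx
      · refine (hullInd_of_notMem fun hm => ?_).symm
        have hr : Set.range v = {v i} := by
          have : Subsingleton (Fin (0 + 1)) := inferInstanceAs (Subsingleton (Fin 1))
          exact Set.range_eq_singleton_iff.2 fun k => by rw [Subsingleton.elim k i]
        rw [hr, convexHull_singleton, Set.mem_singleton_iff] at hm
        rw [hm] at hx
        exact hi.ne hx
      · rfl
    | succ n =>
      have h0 : ∀ᵐ x ∂(μHE[n] : Measure E3), ∀ k : Fin (n + 2), k ≠ i →
          x ∉ convexHull ℝ (Set.range (v ∘ k.succAbove)) ∩ {x | f x = t} := by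
        rw [ae_all_iff]
        intro k
        by_cases hk : k = i
        · exact Eventually.of_forall fun x h => absurd hk h
        obtain ⟨l, hl⟩ := Fin.exists_succAbove_eq (Ne.symm hk)
        have := measure_eq_zero_iff_ae_notMem.1 (hausdorff_convexHull_inter_hyperplane f t
          (v ∘ k.succAbove) (k := l) (by rw [Function.comp_apply, hl]; exact hi.ne))
        filter_upwards [this] with x hx _ using hx
      have hsub : ∀ k : Fin (n + 2), convexHull ℝ (Set.range (v ∘ k.succAbove)) ⊆
          convexHull ℝ (Set.range v) := fun k => convexHull_mono (Set.range_comp_subset_range _ _)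
      filter_upwards [h0] with x hx
      rw [mult_boundary_simplexOf, mult_simplexOf]
      rcases lt_trichotomy (f x) t with hlt | heq | hgt
      · rw [if_pos hlt, if_neg hlt.ne, add_zero]
      · rw [if_neg (by simp [heq]), if_pos heq, zero_add,
          Finset.sum_eq_single i (fun k _ hk => hullInd_of_notMem fun hm => hx k hk ⟨hm, heq⟩)
            (fun h => absurd (Finset.mem_univ i) h)]
        by_cases hm : x ∈ convexHull ℝ (Set.range v)
        · rw [hullInd_of_mem hm, hullInd_of_mem (mem_convexHull_face_of_eq f h hi hm heq)]
        · rw [hullInd_of_notMem hm, hullInd_of_notMem fun hm' => hm (hsub i hm')]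
      · rw [if_neg hgt.not_gt, if_neg hgt.ne', add_zero]
        exact Finset.sum_eq_zero fun k _ => hullInd_of_notMem fun hm =>
          hgt.not_ge (le_of_mem_convexHull_range f h (hsub k hm))

/-- A bisection at a point of the hyperplane reduces the cut of a simplex to those of its halves.
Here both halves have a vertex in the open half-space. -/
theorem IsHalfSpaceCut.bisect {f : E3 →L[ℝ] ℝ} {t : ℝ} {n : ℕ} {v : Fin (n + 2) → E3}
    {i j k : Fin (n + 2)} (hij : i ≠ j) (hki : k ≠ i) (hkj : k ≠ j) (hk : f (v k) ≠ t) {s : ℝ}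
    (hs : s ∈ Set.Ioo (0 : ℝ) 1) {Q₁ Q₂ : PolyChain (n + 2)}
    (h₁ : IsHalfSpaceCut f t (PolyChain.single (simplexOf
      (Function.update v j (AffineMap.lineMap (v i) (v j) s))) 1) Q₁)
    (h₂ : IsHalfSpaceCut f t (PolyChain.single (simplexOf
      (Function.update v i (AffineMap.lineMap (v i) (v j) s))) 1) Q₂) :
    IsHalfSpaceCut f t (PolyChain.single (simplexOf v) 1) (Q₁ + Q₂) := by
  constructor
  · filter_upwards [h₁.mult_eq, h₂.mult_eq, ae_hullInd_bisect v hij hs] with x e₁ e₂ e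
    rw [map_add, e₁, e₂, mult_simplexOf, mult_simplexOf, mult_simplexOf, e]
    split_ifs <;> simp
  · obtain ⟨G, hG, hsub, hmem⟩ := exists_affineSubspace_bisect_inter v hij hs
    have h0 := measure_eq_zero_iff_ae_notMem.1 (hausdorff_affineSubspace_inter_hyperplane f t G
      (Nat.lt_succ_iff.1 hG) (hmem k hki hkj) hk)
    filter_upwards [h₁.mult_boundary_eq, h₂.mult_boundary_eq, ae_sum_hullInd_bisect v hij hs, h0]
      with x e₁ e₂ e hx
    simp only [mult_boundary_simplexOf, mult_simplexOf] at e₁ e₂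
    simp only [map_add, e₁, e₂, mult_boundary_simplexOf, mult_simplexOf, e]
    by_cases hxt : f x = t
    · rw [hullInd_bisect v hij hs fun h => hx ⟨hsub h, hxt⟩]
      simp [hxt]
    · split_ifs <;> abel

/-- If one half of a bisected simplex misses the open half-space, then the cut of the other half is
a cut of the simplex. -/
theorem IsHalfSpaceCut.of_bisect_left {f : E3 →L[ℝ] ℝ} {t : ℝ} {n : ℕ} {v : Fin (n + 2) → E3}
    {i j : Fin (n + 2)} (hij : i ≠ j) (hj : t < f (v j)) {s : ℝ} (hs : s ∈ Set.Ioo (0 : ℝ) 1)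
    (hp : f (AffineMap.lineMap (v i) (v j) s) = t) (hge : ∀ k, k ≠ i → t ≤ f (v k))
    {Q : PolyChain (n + 2)}
    (h : IsHalfSpaceCut f t (PolyChain.single (simplexOf
      (Function.update v j (AffineMap.lineMap (v i) (v j) s))) 1) Q) :
    IsHalfSpaceCut f t (PolyChain.single (simplexOf v) 1) Q := by
  set p := AffineMap.lineMap (v i) (v j) s with hpdef
  have hge' : ∀ k, t ≤ f (Function.update v i p k) := by
    intro k
    by_cases hk : k = i
    · rw [hk, Function.update_self, hp]
    · rw [Function.update_of_ne hk]; exact hge k hk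
  have hmiss : ∀ x, f x < t → x ∉ convexHull ℝ (Set.range (Function.update v i p)) := by
    intro x hx hm
    have := le_of_mem_convexHull_range (-f) (t := -t) (fun k => by simpa using hge' k) hm
    simp only [neg_apply] at this
    linarith
  have hface : ∀ (k : Fin (n + 2)) x, f x < t →
      hullInd (Function.update v i p ∘ k.succAbove) x = 0 := fun k x hx =>
    hullInd_of_notMem fun hm =>
      hmiss x hx (convexHull_mono (Set.range_comp_subset_range _ _) hm)
  have htrace : ∀ x, f x = t → hullInd v x = hullInd (Function.update v j p) x := by
    intro x hx
    have hu := convexHull_bisect (v := v) hij hs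
    rw [← hpdef] at hu
    by_cases hm : x ∈ convexHull ℝ (Set.range (Function.update v j p))
    · rw [hullInd_of_mem hm, hullInd_of_mem (hu ▸ Or.inl hm)]
    · rw [hullInd_of_notMem hm, hullInd_of_notMem]
      intro hm'
      rw [hu] at hm'
      refine hm (hm'.resolve_left hm |> fun h2 => ?_)
      have hmf := mem_convexHull_face_of_eq (-f) (t := -t) (fun k => by simpa using hge' k)
        (i := j) (by simpa [Function.update_of_ne hij.symm] using hj) h2 (by simp [hx])
      refine convexHull_mono ?_ hmf
      rintro _ ⟨l, rfl⟩
      by_cases hl : j.succAbove l = i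
      · refine ⟨j, ?_⟩
        rw [Function.comp_apply, hl, Function.update_self, Function.update_self]
      · refine ⟨j.succAbove l, ?_⟩
        rw [Function.comp_apply, Function.update_of_ne hl,
          Function.update_of_ne (Fin.succAbove_ne j l)]
  constructor
  · filter_upwards [h.mult_eq, ae_hullInd_bisect v hij hs] with x e₁ e
    rw [e₁, mult_simplexOf, mult_simplexOf]
    split_ifs with hlt
    · rw [e, ← hpdef, hullInd_of_notMem (hmiss x hlt), add_zero]
    · rfl
  · filter_upwards [h.mult_boundary_eq, ae_sum_hullInd_bisect v hij hs] with x e₁ e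
    rw [e₁]
    simp only [mult_boundary_simplexOf, mult_simplexOf]
    congr 1
    · split_ifs with hlt
      · rw [e, ← hpdef, Finset.sum_eq_zero (f := fun k : Fin (n + 2) =>
          hullInd (Function.update v i p ∘ k.succAbove) x) (fun k _ => hface k x hlt), add_zero]
      · rfl
    · split_ifs with hx
      · exact (htrace x hx).symm
      · rfl

/-- A simplex with a vertex in the open half-space can be cut: edges that cross the hyperplane are
bisected there until each piece lies on one side. The induction is on the number of vertices
off the hyperplane. -/
theorem exists_isHalfSpaceCut_of_lt (f : E3 →L[ℝ] ℝ) (t : ℝ) {n : ℕ} (N : ℕ) :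
    ∀ v : Fin (n + 1) → E3, (Finset.univ.filter fun k => f (v k) ≠ t).card ≤ N →
      (∃ i, f (v i) < t) → ∃ Q, IsHalfSpaceCut f t (PolyChain.single (simplexOf v) 1) Q := by
  induction N with
  | zero =>
    rintro v hN ⟨i, hi⟩
    have h0 := Finset.card_eq_zero.1 (Nat.le_zero.1 hN)
    have h1 : i ∈ Finset.univ.filter fun k => f (v k) ≠ t :=
      Finset.mem_filter.2 ⟨Finset.mem_univ i, hi.ne⟩
    rw [h0] at h1
    exact absurd h1 (Finset.notMem_empty i)
  | succ N ih =>
    rintro v hN ⟨i, hi⟩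
    by_cases hall : ∀ k, f (v k) ≤ t
    · exact ⟨_, isHalfSpaceCut_self f t v hall hi⟩
    obtain ⟨j, hj⟩ := not_forall.1 hall
    rw [not_le] at hj
    have hij : i ≠ j := by rintro rfl; exact lt_asymm hi hj
    obtain ⟨m, rfl⟩ : ∃ m, n = m + 1 := Nat.exists_eq_succ_of_ne_zero (by
      rintro rfl
      exact hij (Fin.ext (by omega)))
    obtain ⟨s, hs, hp⟩ : ∃ s ∈ Set.Ioo (0 : ℝ) 1, f (AffineMap.lineMap (v i) (v j) s) = t := by
      have hd : 0 < f (v j) - f (v i) := by linarith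
      refine ⟨(t - f (v i)) / (f (v j) - f (v i)), ⟨div_pos (by linarith) hd,
        (div_lt_one hd).2 (by linarith)⟩, ?_⟩
      rw [AffineMap.lineMap_apply_module']
      simp only [map_add, map_smul, map_sub, smul_eq_mul]
      field_simp
      ring
    -- a bisection moves one more vertex into the hyperplane
    have hcard : ∀ l, f (v l) ≠ t → (Finset.univ.filter fun k =>
        f (Function.update v l (AffineMap.lineMap (v i) (v j) s) k) ≠ t).card ≤ N := by
      intro l hl
      refine Nat.le_of_lt_succ (lt_of_lt_of_le (Finset.card_lt_card ?_) hN)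
      refine Finset.ssubset_iff_subset_ne.2 ⟨fun k hk => ?_, fun h => ?_⟩
      · rw [Finset.mem_filter] at hk ⊢
        refine ⟨hk.1, fun hk' => hk.2 ?_⟩
        by_cases hkl : k = l
        · rw [hkl, Function.update_self, hp]
        · rw [Function.update_of_ne hkl, hk']
      · have : l ∈ Finset.univ.filter fun k => f (v k) ≠ t :=
          Finset.mem_filter.2 ⟨Finset.mem_univ l, hl⟩
        rw [← h, Finset.mem_filter, Function.update_self] at this
        exact this.2 hp
    obtain ⟨Q₁, hQ₁⟩ := ih _ (hcard j hj.ne') ⟨i, by rwa [Function.update_of_ne hij]⟩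
    by_cases hk : ∃ k, k ≠ i ∧ f (v k) < t
    · obtain ⟨k, hki, hk⟩ := hk
      have hkj : k ≠ j := by rintro rfl; exact lt_asymm hk hj
      obtain ⟨Q₂, hQ₂⟩ := ih _ (hcard i hi.ne) ⟨k, by rwa [Function.update_of_ne hki]⟩
      exact ⟨Q₁ + Q₂, hQ₁.bisect hij hki hkj hk.ne hs hQ₂⟩
    · push Not at hk
      exact ⟨Q₁, hQ₁.of_bisect_left hij hj hs hp hk⟩

theorem isHalfSpaceCut_zero (f : E3 →L[ℝ] ℝ) (t : ℝ) {m : ℕ} :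
    IsHalfSpaceCut f t (0 : PolyChain (m + 1)) 0 := by
  constructor <;> exact Eventually.of_forall fun x => by simp

theorem isHalfSpaceCut_zero_of_forall_gt {f : E3 →L[ℝ] ℝ} {t : ℝ} {m : ℕ} {v : Fin (m + 1) → E3}
    (h : ∀ k, t < f (v k)) : IsHalfSpaceCut f t (PolyChain.single (simplexOf v) 1) 0 := by
  have hmiss : ∀ x, f x ≤ t → x ∉ convexHull ℝ (Set.range v) := by
    intro x hx hm
    have hsub : convexHull ℝ (Set.range v) ⊆ {x | t < f x} :=
      convexHull_min (by rintro _ ⟨k, rfl⟩; exact h k) (convex_halfSpace_gt f.isLinear t)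
    exact absurd (hsub hm) (not_lt.2 hx)
  constructor <;> refine Eventually.of_forall fun x => ?_
  · rw [map_zero, mult_simplexOf]
    split_ifs with hx
    · exact (hullInd_of_notMem (hmiss x hx.le)).symm
    · rfl
  · have h2 : (if f x = t then PolyChain.mult x (PolyChain.single (simplexOf v) 1) else 0) = 0 := by
      rw [mult_simplexOf]
      split_ifs with hx
      · exact hullInd_of_notMem (hmiss x hx.le)
      · rfl
    rw [h2, map_zero, map_zero, add_zero]
    split_ifs with hx
    · cases m with
      | zero => rw [boundary_zero_apply, map_zero]
      | succ m =>
        rw [mult_boundary_simplexOf]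
        exact (Finset.sum_eq_zero fun k _ => hullInd_of_notMem fun hm =>
          hmiss x hx.le (convexHull_mono (Set.range_comp_subset_range _ _) hm)).symm
    · rfl

/-- A chain can be cut by all but finitely many hyperplanes of a parallel family. -/
theorem exists_isHalfSpaceCut (f : E3 →L[ℝ] ℝ) {m : ℕ} (P : PolyChain (m + 1)) :
    ∃ N : Set ℝ, N.Finite ∧ ∀ t ∉ N, ∃ Q, IsHalfSpaceCut f t P Q := by
  refine Finsupp.induction_linear (motive := fun P : PolyChain (m + 1) =>
    ∃ N : Set ℝ, N.Finite ∧ ∀ t ∉ N, ∃ Q, IsHalfSpaceCut f t P Q) P ?_ ?_ ?_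
  · exact ⟨∅, Set.finite_empty, fun t _ => ⟨0, isHalfSpaceCut_zero f t⟩⟩
  · rintro P P' ⟨N, hN, h⟩ ⟨N', hN', h'⟩
    refine ⟨N ∪ N', hN.union hN', fun t ht => ?_⟩
    rw [Set.mem_union, not_or] at ht
    obtain ⟨Q, hQ⟩ := h t ht.1
    obtain ⟨Q', hQ'⟩ := h' t ht.2
    exact ⟨Q + Q', hQ.add hQ'⟩
  · intro σ a
    -- no vertex of `σ` lies in a hyperplane at another level, so a simplex with no vertex in the
    -- open half-space misses its closure
    refine ⟨Set.range (f ∘ σ.vertex), Set.finite_range _, fun t ht => ?_⟩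
    change ∃ Q, IsHalfSpaceCut f t (PolyChain.single (simplexOf σ.vertex) a) Q
    have ha : a = 0 ∨ a = 1 := by revert a; decide
    rcases ha with rfl | rfl
    · rw [map_zero]
      exact ⟨0, isHalfSpaceCut_zero f t⟩
    by_cases hlt : ∃ i, f (σ.vertex i) < t
    · exact exists_isHalfSpaceCut_of_lt f t _ σ.vertex le_rfl hlt
    · push Not at hlt
      exact ⟨0, isHalfSpaceCut_zero_of_forall_gt fun k =>
        lt_of_le_of_ne (hlt k) fun h => ht ⟨k, h.symm⟩⟩

/-! ### Restrictions of chains and the flat norm -/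

theorem PolyChain.flatNorm_le_mass {m : ℕ} (P : PolyChain m) : P.flatNorm ≤ P.mass := by
  have h := PolyChain.flatNorm_le (P := P) (Q := P) (R := 0) (by simp)
  simpa [PolyChain.mass_zero] using h

theorem PolyChain.flatNorm_sub {m : ℕ} (P P' : PolyChain m) :
    (P - P').flatNorm ≤ P.flatNorm + P'.flatNorm := by
  rw [sub_eq_add_neg, ← PolyChain.flatNorm_neg P']
  exact PolyChain.flatNorm_add _ _

instance : Subsingleton (PolyChain 0) := by
  have : IsEmpty (Simplex 0) := ⟨fun σ => lt_irrefl _ σ.pos⟩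
  exact inferInstanceAs (Subsingleton (Simplex 0 →₀ ZMod 2))

theorem PolyChain.measure_apply {m : ℕ} (P : PolyChain m) {X : Set E3} (hX : MeasurableSet X) :
    P.measure X = (μHE[m - 1] : Measure E3) (X ∩ {x | PolyChain.mult x P ≠ 0}) :=
  Measure.restrict_apply hX

/-- The chain `D` represents the part of the chain `P` in the set `W`. -/
def IsRestriction {m : ℕ} (W : Set E3) (P D : PolyChain m) : Prop :=
  ∀ᵐ x ∂(μHE[m - 1] : Measure E3),
    PolyChain.mult x D = W.indicator (fun x => PolyChain.mult x P) x

/-- Replacing `P` by `P'` in the set `W`. -/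
theorem IsRestriction.measure_sub {m : ℕ} {W : Set E3} (hW : MeasurableSet W)
    {P P' D : PolyChain m} (h : IsRestriction W (P - P') D) {X : Set E3} (hX : MeasurableSet X) :
    (P - D).measure X = P.measure (X \ W) + P'.measure (X ∩ W) := by
  rw [PolyChain.measure_apply _ hX, PolyChain.measure_apply _ (MeasurableSet.diff hX hW),
    PolyChain.measure_apply _ (hX.inter hW), ← measure_inter_add_sdiff _ hW, add_comm]
  congr 1 <;> refine measure_congr ?_
  · filter_upwards [h] with x hx
    refine propext ?_
    change (x ∈ X ∧ PolyChain.mult x (P - D) ≠ 0) ∧ x ∉ W ↔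
      (x ∈ X ∧ x ∉ W) ∧ PolyChain.mult x P ≠ 0
    by_cases hxW : x ∈ W
    · simp [hxW]
    · rw [map_sub, hx, Set.indicator_of_notMem hxW, sub_zero]
      tauto
  · filter_upwards [h] with x hx
    refine propext ?_
    change (x ∈ X ∧ PolyChain.mult x (P - D) ≠ 0) ∧ x ∈ W ↔
      (x ∈ X ∧ x ∈ W) ∧ PolyChain.mult x P' ≠ 0
    by_cases hxW : x ∈ W
    · rw [map_sub, hx, Set.indicator_of_mem hxW, map_sub, sub_sub_cancel]
      tauto
    · simp [hxW]

theorem IsRestriction.measure_eq {m : ℕ} {W : Set E3} (hW : MeasurableSet W)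
    {P D : PolyChain m} (h : IsRestriction W P D) {X : Set E3} (hX : MeasurableSet X) :
    D.measure X = P.measure (X ∩ W) := by
  rw [PolyChain.measure_apply _ hX, PolyChain.measure_apply _ (hX.inter hW)]
  refine measure_congr ?_
  filter_upwards [h] with x hx
  refine propext ?_
  change (x ∈ X ∧ PolyChain.mult x D ≠ 0) ↔ (x ∈ X ∧ x ∈ W) ∧ PolyChain.mult x P ≠ 0
  by_cases hxW : x ∈ W
  · rw [hx, Set.indicator_of_mem hxW]; tauto
  · rw [hx, Set.indicator_of_notMem hxW]; tauto

/-- Every polyhedral chain has a polyhedral restriction to some set between `K` and `U` whose flat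
norm exceeds that of the chain at most by the factor `C`. -/
def Separates (m : ℕ) (C : NNReal) (K U : Set E3) : Prop :=
  ∀ (P : PolyChain m) (δ : ℝ≥0∞), P.flatNorm < δ → δ ≠ ⊤ →
    ∃ W, MeasurableSet W ∧ K ⊆ W ∧ W ⊆ U ∧ ∃ D, IsRestriction W P D ∧ D.flatNorm < C * δ

/-- Two parallel hyperplanes separate the half-spaces that they bound: if `P = Q + ∂R`, then the
restriction of `P` to a half-space between the two is the sum of the restriction of `Q`, the
boundary of the restriction of `R`, and a slice of `R`, whose mass is controlled by the Eilenberg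
inequality for a suitable half-space. The constant depends only on the distance of the
hyperplanes. -/
theorem exists_separates_halfSpace (m : ℕ) {r : ℝ} (hr : 0 < r) :
    ∃ C : NNReal, ∀ {f : E3 →L[ℝ] ℝ}, LipschitzWith 1 f → ∀ a : ℝ,
      Separates m C {x | f x ≤ a} {x | f x < a + r} := by
  cases m with
  | zero =>
    refine ⟨1, fun {f} hf a P δ hP _ => ⟨{x | f x < a + r},
      measurableSet_lt f.measurable measurable_const,
      fun x (hx : f x ≤ a) => hx.trans_lt (lt_add_of_pos_right a hr), subset_rfl, 0, ?_, ?_⟩⟩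
    · refine Eventually.of_forall fun x => ?_
      rw [Subsingleton.elim P 0]
      simp
    · rw [PolyChain.flatNorm_zero]
      simpa using bot_le.trans_lt hP
  | succ l =>
    obtain ⟨C, hC⟩ := exists_slice_le l
    refine ⟨1 + C / Real.toNNReal r, fun {f} hf a P δ hP hδtop => ?_⟩
    simp only [PolyChain.flatNorm, iInf_lt_iff] at hP
    obtain ⟨Q, R, hPQR, hδ⟩ := hP
    have hR : (μHE[l + 1] : Measure E3) {x | PolyChain.mult x R ≠ 0} = R.mass :=
      (PolyChain.mass_eq R).symm
    have hRfin : R.mass ≠ ⊤ := ((le_add_self).trans_lt hδ).ne_top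
    obtain ⟨NP, hNP, hP'⟩ := exists_isHalfSpaceCut f P
    obtain ⟨NQ, hNQ, hQ'⟩ := exists_isHalfSpaceCut f Q
    obtain ⟨NR, hNR, hR'⟩ := exists_isHalfSpaceCut f R
    obtain ⟨t, ht, htN, hslice⟩ := hC hf {x | PolyChain.mult x R ≠ 0} (by rwa [hR])
      (lt_add_of_pos_right a hr)
      (NP ∪ NQ ∪ NR) ((hNP.union hNQ).union hNR).countable
    rw [add_sub_cancel_left] at hslice
    simp only [Set.mem_union, not_or] at htN
    obtain ⟨P', hP'⟩ := hP' t htN.1.1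
    obtain ⟨Q', hQ'⟩ := hQ' t htN.1.2
    obtain ⟨R', hR'⟩ := hR' t htN.2
    -- `S` is the slice of `R` at the level `t`
    set S := P' - Q' - PolyChain.boundary (l + 1) R' with hS
    have hSmult : ∀ᵐ x ∂(μHE[l] : Measure E3),
        PolyChain.mult x S = if f x = t then PolyChain.mult x R else 0 := by
      have hRb : ∀ᵐ x ∂(μHE[l] : Measure E3), _ := hR'.mult_boundary_eq
      filter_upwards [hP'.mult_eq, hQ'.mult_eq, hRb] with x e₁ e₂ e₃
      rw [hS, map_sub, map_sub, e₁, e₂, e₃, hPQR, map_add]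
      have h2 := CharTwo.add_self_eq_zero (if f x = t then PolyChain.mult x R else 0)
      split_ifs at h2 ⊢ <;> linear_combination -h2
    have hmono : ∀ {n : ℕ} {A A' : PolyChain (n + 1)}, (∀ᵐ x ∂(μHE[n] : Measure E3),
        PolyChain.mult x A' = if f x < t then PolyChain.mult x A else 0) → A'.mass ≤ A.mass := by
      intro n A A' h
      rw [PolyChain.mass_eq, PolyChain.mass_eq]
      refine measure_mono_ae ?_
      -- the dimension `n` is written as `n + 1 - 1` in the measure of a chain
      have h : ∀ᵐ x ∂(μHE[n + 1 - 1] : Measure E3), _ := h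
      filter_upwards [h] with x hx hx0 hA
      refine hx0 (hx.trans ?_)
      rw [hA, ite_self]
    have hSmass : S.mass ≤ (C / Real.toNNReal r : NNReal) * R.mass := by
      have hpos : Real.toNNReal r ≠ 0 := by simpa using hr
      rw [PolyChain.mass_eq, ENNReal.coe_div hpos, ← hR]
      refine le_trans (measure_mono_ae ?_) hslice
      have h : ∀ᵐ x ∂(μHE[l + 1 - 1] : Measure E3), _ := hSmult
      filter_upwards [h] with x hx hx0
      change PolyChain.mult x S ≠ 0 at hx0
      rw [hx] at hx0
      by_cases hxt : f x = t
      · rw [if_pos hxt] at hx0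
        exact ⟨hx0, hxt⟩
      · exact absurd (if_neg hxt) hx0
    refine ⟨{x | f x < t}, measurableSet_lt f.measurable measurable_const,
      fun x (hx : f x ≤ a) => hx.trans_lt ht.1, fun x (hx : f x < t) => hx.trans ht.2, P', ?_, ?_⟩
    · have h : ∀ᵐ x ∂(μHE[l + 1 - 1] : Measure E3), _ := hP'.mult_eq
      filter_upwards [h] with x hx
      rw [hx]
      by_cases hlt : f x < t
      · rw [if_pos hlt, Set.indicator_of_mem (by exact hlt)]
      · rw [if_neg hlt, Set.indicator_of_notMem (by exact hlt)]
    · calc P'.flatNorm ≤ (Q' + S).mass + R'.mass :=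
            PolyChain.flatNorm_le (by rw [hS]; abel)
        _ ≤ (Q'.mass + S.mass) + R'.mass := by gcongr; exact PolyChain.mass_add _ _
        _ ≤ (Q.mass + (C / Real.toNNReal r : NNReal) * R.mass) + R.mass := by
            gcongr
            · exact hmono hQ'.mult_eq
            · exact hmono hR'.mult_eq
        _ = (Q.mass + R.mass) + (C / Real.toNNReal r : NNReal) * R.mass := by ring
        _ < δ + (C / Real.toNNReal r : NNReal) * δ := by
            refine ENNReal.add_lt_add_of_lt_of_le
              (ENNReal.mul_ne_top ENNReal.coe_ne_top hRfin) hδ ?_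
            gcongr
            exact le_add_self.trans hδ.le
        _ = _ := by push_cast; ring

theorem Separates.mono {m : ℕ} {C : NNReal} {K K' U U' : Set E3} (h : Separates m C K U)
    (hK : K' ⊆ K) (hU : U ⊆ U') : Separates m C K' U' := by
  intro P δ hP hδ
  obtain ⟨W, hW, h1, h2, D, hD⟩ := h P δ hP hδ
  exact ⟨W, hW, hK.trans h1, h2.trans hU, D, hD⟩

theorem separates_empty (m : ℕ) (U : Set E3) : Separates m 1 ∅ U :=
  fun P δ h _ => ⟨∅, .empty, subset_rfl, Set.empty_subset _, 0,
    Eventually.of_forall fun x => by simp, by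
      simpa [PolyChain.flatNorm_zero] using bot_le.trans_lt h⟩

theorem separates_univ (m : ℕ) : Separates m 1 Set.univ Set.univ :=
  fun P δ h _ => ⟨Set.univ, .univ, subset_rfl, subset_rfl, P,
    Eventually.of_forall fun x => by simp, by simpa using h⟩

theorem Separates.inter {m : ℕ} {C₁ C₂ : NNReal} {K₁ K₂ U₁ U₂ : Set E3} (h₁ : Separates m C₁ K₁ U₁)
    (h₂ : Separates m C₂ K₂ U₂) : Separates m (C₂ * C₁) (K₁ ∩ K₂) (U₁ ∩ U₂) := by
  intro P δ hP hδ
  obtain ⟨W₁, hW₁, hK₁, hU₁, D₁, hD₁, hlt₁⟩ := h₁ P δ hP hδ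
  obtain ⟨W₂, hW₂, hK₂, hU₂, D₂, hD₂, hlt₂⟩ :=
    h₂ D₁ _ hlt₁ (ENNReal.mul_ne_top ENNReal.coe_ne_top hδ)
  refine ⟨W₁ ∩ W₂, hW₁.inter hW₂, Set.inter_subset_inter hK₁ hK₂, Set.inter_subset_inter hU₁ hU₂,
    D₂, ?_, by rwa [ENNReal.coe_mul, mul_assoc]⟩
  filter_upwards [hD₁, hD₂] with x e₁ e₂
  rw [e₂]
  by_cases h1 : x ∈ W₁ <;> by_cases h2 : x ∈ W₂ <;> simp [h1, h2, e₁]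

/-- The union restricts `P` to the first set and then the remainder to the second one. -/
theorem Separates.union {m : ℕ} {C₁ C₂ : NNReal} {K₁ K₂ U₁ U₂ : Set E3} (h₁ : Separates m C₁ K₁ U₁)
    (h₂ : Separates m C₂ K₂ U₂) : Separates m (C₁ + C₂ * (1 + C₁)) (K₁ ∪ K₂) (U₁ ∪ U₂) := by
  intro P δ hP hδ
  obtain ⟨W₁, hW₁, hK₁, hU₁, D₁, hD₁, hlt₁⟩ := h₁ P δ hP hδ
  have hlt : (P - D₁).flatNorm < (1 + C₁) * δ := by
    rw [add_mul, one_mul]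
    exact (PolyChain.flatNorm_sub _ _).trans_lt (ENNReal.add_lt_add hP hlt₁)
  obtain ⟨W₂, hW₂, hK₂, hU₂, D₂, hD₂, hlt₂⟩ := h₂ (P - D₁) _ hlt
    (ENNReal.mul_ne_top (by simp) hδ)
  refine ⟨W₁ ∪ W₂, hW₁.union hW₂, Set.union_subset_union hK₁ hK₂, Set.union_subset_union hU₁ hU₂,
    D₁ + D₂, ?_, ?_⟩
  · filter_upwards [hD₁, hD₂] with x e₁ e₂
    rw [map_add, e₂]
    by_cases h1 : x ∈ W₁ <;> by_cases h2 : x ∈ W₂ <;> simp [h1, h2, e₁]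
  · refine (PolyChain.flatNorm_add _ _).trans_lt ((ENNReal.add_lt_add hlt₁ hlt₂).trans_eq ?_)
    push_cast
    ring

theorem separates_biInter {m : ℕ} {C : NNReal} {ι : Type*} (s : Finset ι) {K U : ι → Set E3}
    (h : ∀ i, Separates m C (K i) (U i)) :
    Separates m (C ^ s.card) (⋂ i ∈ s, K i) (⋂ i ∈ s, U i) := by
  classical
  induction s using Finset.induction_on with
  | empty => simpa using separates_univ m
  | insert i s hi ih =>
    rw [Finset.card_insert_of_notMem hi, pow_succ]
    simp only [Finset.set_biInter_insert]
    exact (h i).inter ih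

/-- Concentric cubes are separated, with a constant that depends only on their distance. -/
theorem exists_separates_cube (m : ℕ) {r : ℝ} (hr : 0 < r) :
    ∃ C : NNReal, ∀ (c : E3) (s : ℝ),
      Separates m C {x | ∀ i, |x i - c i| ≤ s} {x | ∀ i, |x i - c i| < s + r} := by
  have hlip : ∀ i : Fin 3, LipschitzWith 1 (EuclideanSpace.proj i : E3 →L[ℝ] ℝ) := fun i =>
    LipschitzWith.of_dist_le_mul fun x y => by
      have := PiLp.norm_apply_le (x - y) i
      simpa [dist_eq_norm] using this
  obtain ⟨C, hC⟩ := exists_separates_halfSpace m hr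
  -- a cube is the intersection of three slabs, each the intersection of two half-spaces
  refine ⟨(C * C) ^ (Finset.univ : Finset (Fin 3)).card, fun c s => ?_⟩
  have h : ∀ i : Fin 3,
      Separates m (C * C) {x : E3 | |x i - c i| ≤ s} {x : E3 | |x i - c i| < s + r} := by
    intro i
    have h1 := hC (hlip i) (c i + s)
    have h2 := hC (f := -(EuclideanSpace.proj i : E3 →L[ℝ] ℝ))
      (by simpa using (hlip i).neg) (-c i + s)
    refine (h1.inter h2).mono ?_ ?_
    · intro x hx
      have hx : |x i - c i| ≤ s := hx
      rw [abs_le] at hx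
      constructor
      · change x i ≤ c i + s
        linarith
      · change -x i ≤ -c i + s
        linarith
    · rintro x ⟨h1, h2⟩
      have h1 : x i < c i + s + r := h1
      have h2 : -x i < -c i + s + r := h2
      change |x i - c i| < s + r
      rw [abs_lt]
      constructor <;> linarith
  refine (separates_biInter Finset.univ h).mono (fun x hx => ?_) (fun x hx => ?_)
  · simpa using hx
  · simpa using hx

/-- A compact set can be separated from the complement of any neighborhood by finitely many
cubes. -/
theorem exists_separates_of_isCompact (m : ℕ) {K U : Set E3} (hK : IsCompact K) (hU : IsOpen U)
    (hKU : K ⊆ U) : ∃ C, Separates m C K U := by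
  refine hK.induction_on (p := fun s => ∃ C, Separates m C s U) ⟨1, separates_empty m U⟩
    (fun s t hst ⟨C, h⟩ => ⟨C, h.mono hst subset_rfl⟩)
    (fun s t ⟨_, hs⟩ ⟨_, ht⟩ => ⟨_, (hs.union ht).mono subset_rfl (Set.union_self U).subset⟩)
    fun x hx => ?_
  obtain ⟨ε, hε, hball⟩ := Metric.isOpen_iff.1 hU x (hKU hx)
  -- a cube of half-width `ε / 2` lies in the ball of radius `ε`, since `√3 < 2`
  have hr : 0 < ε / 4 := by linarith
  obtain ⟨C, hC⟩ := exists_separates_cube m hr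
  refine ⟨{y | ∀ i, |y i - x i| ≤ ε / 4}, mem_nhdsWithin_of_mem_nhds ?_,
    C, (hC x (ε / 4)).mono subset_rfl fun y hy => hball ?_⟩
  · filter_upwards [Metric.ball_mem_nhds x hr] with y hy i
    have := PiLp.norm_apply_le (y - x) i
    rw [Metric.mem_ball, dist_eq_norm] at hy
    exact this.trans hy.le
  · rw [Metric.mem_ball, EuclideanSpace.dist_eq, Real.sqrt_lt' hε]
    have h2 : ∀ i, dist (y i) (x i) ^ 2 < (ε / 4 + ε / 4) ^ 2 := fun i => by
      rw [Real.dist_eq]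
      exact pow_lt_pow_left₀ (hy i) (abs_nonneg _) two_ne_zero
    rw [Fin.sum_univ_three]
    nlinarith [h2 0, h2 1, h2 2]

/-! ### Convergence to a flat chain and lower semicontinuity of mass -/

theorem tendsto_flatNorm_sub {m : ℕ} {ι : Type*} {l : Filter ι} {B : FlatChain m}
    {P P' : ι → PolyChain m} (hP : Tendsto (fun i => (P i : FlatChain m)) l (𝓝 B))
    (hP' : Tendsto (fun i => (P' i : FlatChain m)) l (𝓝 B)) :
    Tendsto (fun i => (P i - P' i).flatNorm) l (𝓝 0) := by
  have h : Tendsto (fun i => ((P i - P' i : PolyChain m) : FlatChain m)) l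
      (𝓝 ((0 : PolyChain m) : FlatChain m)) := by
    simpa [Completion.coe_sub, Completion.coe_zero] using hP.sub hP'
  have h2 : Tendsto (fun i => P i - P' i) l (𝓝 0) :=
    (Completion.isUniformInducing_coe (PolyChain m)).isInducing.tendsto_nhds_iff.2 h
  rw [tendsto_iff_edist_tendsto_0] at h2
  simpa [PolyChain.edist_eq] using h2

theorem tendsto_of_flatNorm_sub {m : ℕ} {ι : Type*} {l : Filter ι} {B : FlatChain m}
    {P P' : ι → PolyChain m} (hP : Tendsto (fun i => (P i : FlatChain m)) l (𝓝 B))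
    (h : Tendsto (fun i => (P' i - P i).flatNorm) l (𝓝 0)) :
    Tendsto (fun i => (P' i : FlatChain m)) l (𝓝 B) := by
  have h2 : Tendsto (fun i => P' i - P i) l (𝓝 0) := by
    rw [tendsto_iff_edist_tendsto_0]
    simpa [PolyChain.edist_eq] using h
  have h3 : Tendsto (fun i => ((P' i - P i : PolyChain m) : FlatChain m)) l
      (𝓝 ((0 : PolyChain m) : FlatChain m)) :=
    (Completion.continuous_coe (PolyChain m)).continuousAt.tendsto.comp h2
  simpa [Completion.coe_sub, Completion.coe_zero] using h3.add hP

theorem exists_forall_ge_flatNorm_sub_lt {m : ℕ} {B : FlatChain m} {P P' : ℕ → PolyChain m}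
    (hP : Tendsto (fun i => (P i : FlatChain m)) atTop (𝓝 B))
    (hP' : Tendsto (fun i => (P' i : FlatChain m)) atTop (𝓝 B)) {δ : ℝ≥0∞} (hδ : 0 < δ) :
    ∃ N, ∀ i ≥ N, ∀ j ≥ N, (P i - P' j).flatNorm < δ := by
  have h := tendsto_flatNorm_sub (l := (atTop : Filter (ℕ × ℕ)))
    (P := fun p => P p.1) (P' := fun p => P' p.2)
    (hP.comp (tendsto_fst.comp (prod_atTop_atTop_eq (α := ℕ) (β := ℕ)).ge))
    (hP'.comp (tendsto_snd.comp (prod_atTop_atTop_eq (α := ℕ) (β := ℕ)).ge))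
  obtain ⟨⟨a, b⟩, hab⟩ := eventually_atTop.1 (h.eventually (gt_mem_nhds hδ))
  exact ⟨max a b, fun i hi j hj => hab (i, j)
    ⟨(le_max_left _ _).trans hi, (le_max_right _ _).trans hj⟩⟩

theorem flatMass_le_liminf {m : ℕ} {B : FlatChain m} {P : ℕ → PolyChain m}
    (hP : Tendsto (fun i => (P i : FlatChain m)) atTop (𝓝 B)) :
    flatMass B ≤ liminf (fun i => (P i).mass) atTop :=
  iInf₂_le P hP

/-- The mass of polyhedral chains near a flat chain of finite mass is not much smaller than its
mass. -/
theorem exists_flatMass_le_mass_add {m : ℕ} {B : FlatChain m} {P : ℕ → PolyChain m}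
    (hP : Tendsto (fun i => (P i : FlatChain m)) atTop (𝓝 B)) (hB : flatMass B ≠ ⊤) {ε : ℝ≥0∞}
    (hε : ε ≠ 0) : ∃ δ > 0, ∀ᶠ i in atTop, ∀ P' : PolyChain m, (P' - P i).flatNorm < δ →
      flatMass B ≤ P'.mass + ε := by
  by_contra! h
  have h' : ∀ n : ℕ, ∃ i ≥ n, ∃ P' : PolyChain m, (P' - P i).flatNorm < ((n : ℝ≥0∞) + 1)⁻¹ ∧
      P'.mass + ε < flatMass B := fun n => by
    have := h ((n : ℝ≥0∞) + 1)⁻¹ (by simp [ENNReal.inv_pos])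
    exact (frequently_atTop.1 this) n
  choose i hi P' hP' hlt using h'
  have hconv : Tendsto (fun n => (P' n : FlatChain m)) atTop (𝓝 B) := by
    refine tendsto_of_flatNorm_sub (hP.comp (tendsto_atTop_mono hi tendsto_id)) ?_
    exact tendsto_of_tendsto_of_tendsto_of_le_of_le tendsto_const_nhds tendsto_inv_nat_add_one
      (fun _ => bot_le) fun n => (hP' n).le
  have hle : flatMass B ≤ flatMass B - ε :=
    (flatMass_le_liminf hconv).trans (liminf_le_of_le (by isBoundedDefault) fun b hb => by
      obtain ⟨n, hn⟩ := hb.exists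
      exact hn.trans (ENNReal.le_sub_of_add_le_right
        ((le_add_self.trans_lt (hlt n)).trans_le le_top).ne (hlt n).le))
  have hpos : flatMass B ≠ 0 := (bot_le.trans_lt (hlt 0)).ne'
  exact absurd hle (not_le.2 (ENNReal.sub_lt_self hB hpos hε))

/-- A sequence of polyhedral chains that realizes the mass of a flat chain. -/
structure IsMinimizing {m : ℕ} (B : FlatChain m) (P : ℕ → PolyChain m) : Prop where
  tendsto : Tendsto (fun i => (P i : FlatChain m)) atTop (𝓝 B)
  tendsto_mass : Tendsto (fun i => (P i).mass) atTop (𝓝 (flatMass B))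

/-- A diagonal sequence attains the infimum in the definition of the mass of a flat chain. -/
theorem exists_isMinimizing {m : ℕ} {B : FlatChain m} (hB : flatMass B ≠ ⊤) :
    ∃ P, IsMinimizing B P := by
  have hn0 : ∀ n : ℕ, (0 : ℝ≥0∞) < ((n : ℝ≥0∞) + 1)⁻¹ := fun n => by simp [ENNReal.inv_pos]
  have h : ∀ n : ℕ, ∃ P : ℕ → PolyChain m,
      Tendsto (fun i => (P i : FlatChain m)) atTop (𝓝 B) ∧
        liminf (fun i => (P i).mass) atTop < flatMass B + ((n : ℝ≥0∞) + 1)⁻¹ := fun n => by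
    have h1 : flatMass B < flatMass B + ((n : ℝ≥0∞) + 1)⁻¹ := ENNReal.lt_add_right hB (hn0 n).ne'
    conv_lhs at h1 => unfold flatMass
    simp only [iInf_lt_iff] at h1
    obtain ⟨P, hP, hlt⟩ := h1
    exact ⟨P, hP, hlt⟩
  choose P hP hlt using h
  have hi : ∀ n : ℕ, ∃ i ≥ n, (P n i - P 0 i).flatNorm < ((n : ℝ≥0∞) + 1)⁻¹ ∧
      (P n i).mass < flatMass B + ((n : ℝ≥0∞) + 1)⁻¹ := fun n => by
    obtain ⟨N, hN⟩ := exists_forall_ge_flatNorm_sub_lt (hP n) (hP 0) (hn0 n)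
    have hf := frequently_lt_of_liminf_lt (by isBoundedDefault) (hlt n)
    obtain ⟨i, hi, hm⟩ := frequently_atTop.1 hf (max n N)
    have hiN : N ≤ i := (le_max_right _ _).trans hi
    exact ⟨i, (le_max_left _ _).trans hi, hN i hiN i hiN, hm⟩
  choose i hin hd hm using hi
  have hconv : Tendsto (fun n => (P n (i n) : FlatChain m)) atTop (𝓝 B) := by
    refine tendsto_of_flatNorm_sub ((hP 0).comp (tendsto_atTop_mono hin tendsto_id)) ?_
    exact tendsto_of_tendsto_of_tendsto_of_le_of_le tendsto_const_nhds tendsto_inv_nat_add_one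
      (fun _ => bot_le) fun n => (hd n).le
  refine ⟨fun n => P n (i n), hconv, ?_⟩
  refine tendsto_of_le_liminf_of_limsup_le (flatMass_le_liminf hconv) ?_
  have ht : Tendsto (fun n : ℕ => flatMass B + ((n : ℝ≥0∞) + 1)⁻¹) atTop (𝓝 (flatMass B + 0)) :=
    tendsto_const_nhds.add tendsto_inv_nat_add_one
  refine (limsup_le_limsup (Eventually.of_forall fun n => (hm n).le)).trans_eq ?_
  rw [ht.limsup_eq, add_zero]

theorem IsMinimizing.eventually_mass_lt {m : ℕ} {B : FlatChain m} {P : ℕ → PolyChain m}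
    (hP : IsMinimizing B P) (hB : flatMass B ≠ ⊤) {ε : ℝ≥0∞} (hε : ε ≠ 0) :
    ∀ᶠ i in atTop, (P i).mass < flatMass B + ε :=
  hP.tendsto_mass.eventually (gt_mem_nhds (ENNReal.lt_add_right hB hε))

theorem IsRestriction.neg {m : ℕ} {W : Set E3} {P P' D : PolyChain m}
    (h : IsRestriction W (P - P') D) : IsRestriction W (P' - P) (-D) := by
  filter_upwards [h] with x hx
  rw [map_neg, hx]
  by_cases hxW : x ∈ W <;> simp [hxW]

/-- The comparison principle: a minimizing sequence can hardly have more mass anywhere than other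
chains near its limit, as it could be improved by exchanging the two there. -/
theorem IsMinimizing.exists_measure_le {m : ℕ} {B : FlatChain m} {P : ℕ → PolyChain m}
    (hP : IsMinimizing B P) (hB : flatMass B ≠ ⊤) (C : NNReal) {ε : ℝ≥0∞} (hε : ε ≠ 0) :
    ∃ δ > 0, ∃ N, ∀ i ≥ N, ∀ P' : PolyChain m, (P i - P').flatNorm < δ →
      ∀ K U : Set E3, Separates m C K U →
        (P i).measure K ≤ P'.measure U + ε ∧ (P i).measure Uᶜ ≤ P'.measure Kᶜ + ε := by
  have hε2 : ε / 2 ≠ 0 := (ENNReal.half_pos hε).ne'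
  obtain ⟨δ₀, hδ₀, hev⟩ := exists_flatMass_le_mass_add hP.tendsto hB hε2
  set δ := min δ₀ 1 / (C + 1) with hδ
  have hC1 : ((C : ℝ≥0∞) + 1) ≠ ⊤ := by simp
  have hδpos : 0 < δ := ENNReal.div_pos (lt_min hδ₀ one_pos).ne' hC1
  have hδtop : δ ≠ ⊤ := (ENNReal.div_lt_top (ne_top_of_le_ne_top ENNReal.one_ne_top
    (min_le_right _ _)) (by simp)).ne
  have hδC : δ + C * δ ≤ δ₀ := by
    have : δ + C * δ = (C + 1) * δ := by ring
    rw [this, hδ, ENNReal.mul_div_cancel (by simp) hC1]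
    exact min_le_left _ _
  obtain ⟨N, hN⟩ := eventually_atTop.1 (hev.and (hP.eventually_mass_lt hB hε2))
  refine ⟨δ, hδpos, N, fun i hi P' hP' K U hKU => ?_⟩
  obtain ⟨hlsc, hmass⟩ := hN i hi
  obtain ⟨W, hW, hKW, hWU, D, hD, hDlt⟩ := hKU (P i - P') δ hP' hδtop
  have htot : (P i).measure W + (P i).measure Wᶜ = (P i).mass := measure_add_measure_compl hW
  have hfin : (P i).mass ≠ ⊤ := (hmass.trans_le le_top).ne
  have hWfin : (P i).measure W ≠ ⊤ := ne_top_of_le_ne_top hfin (htot ▸ le_self_add)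
  have hWcfin : (P i).measure Wᶜ ≠ ⊤ := ne_top_of_le_ne_top hfin (htot ▸ le_add_self)
  -- exchange `P i` and `P'` in `W`: both resulting chains are near `B`, so neither of them has much
  -- less mass than `P i`
  constructor
  · have hle := hlsc (P i - D) (by
      rw [sub_sub_cancel_left, PolyChain.flatNorm_neg]
      exact hDlt.trans_le (le_add_self.trans hδC))
    rw [PolyChain.mass, hD.measure_sub hW .univ, ← Set.compl_eq_univ_sdiff, Set.univ_inter] at hle
    have h1 : (P i).measure W + (P i).measure Wᶜ ≤
        (P'.measure W + ε) + (P i).measure Wᶜ := by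
      calc _ = (P i).mass := htot
        _ ≤ flatMass B + ε / 2 := hmass.le
        _ ≤ ((P i).measure Wᶜ + P'.measure W + ε / 2) + ε / 2 := by gcongr
        _ = (P'.measure W + (ε / 2 + ε / 2)) + (P i).measure Wᶜ := by ring
        _ = _ := by rw [ENNReal.add_halves]
    exact (measure_mono hKW).trans (((ENNReal.add_le_add_iff_right hWcfin).1 h1).trans
      (by gcongr))
  · have hle := hlsc (P' - -D) (by
      have e : P' - -D - P i = -(P i - P') + D := by abel
      rw [e]
      refine (PolyChain.flatNorm_add _ _).trans_lt ?_
      rw [PolyChain.flatNorm_neg]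
      exact (ENNReal.add_lt_add hP' hDlt).trans_le hδC)
    rw [PolyChain.mass, hD.neg.measure_sub hW .univ, ← Set.compl_eq_univ_sdiff,
      Set.univ_inter] at hle
    have h1 : (P i).measure W + (P i).measure Wᶜ ≤
        (P i).measure W + (P'.measure Wᶜ + ε) := by
      calc _ = (P i).mass := htot
        _ ≤ flatMass B + ε / 2 := hmass.le
        _ ≤ (P'.measure Wᶜ + (P i).measure W + ε / 2) + ε / 2 := by gcongr
        _ = (P i).measure W + (P'.measure Wᶜ + (ε / 2 + ε / 2)) := by ring
        _ = _ := by rw [ENNReal.add_halves]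
    exact (measure_mono (Set.compl_subset_compl.2 hWU)).trans
      (((ENNReal.add_le_add_iff_left hWfin).1 h1).trans (by gcongr))

theorem IsMinimizing.exists_measure_isCompact_le {m : ℕ} {B : FlatChain m}
    {P P' : ℕ → PolyChain m} (hP : IsMinimizing B P) (hB : flatMass B ≠ ⊤)
    (hP' : Tendsto (fun i => (P' i : FlatChain m)) atTop (𝓝 B)) {K U : Set E3}
    (hK : IsCompact K) (hU : IsOpen U) (hKU : K ⊆ U) {ε : ℝ≥0∞} (hε : ε ≠ 0) :
    ∃ N, ∀ i ≥ N, ∀ j ≥ N, (P i).measure K ≤ (P' j).measure U + ε := by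
  obtain ⟨C, hC⟩ := exists_separates_of_isCompact m hK hU hKU
  obtain ⟨δ, hδ, N, hN⟩ := hP.exists_measure_le hB C hε
  obtain ⟨N', hN'⟩ := exists_forall_ge_flatNorm_sub_lt hP.tendsto hP' hδ
  exact ⟨max N N', fun i hi j hj => (hN i ((le_max_left _ _).trans hi) (P' j)
    (hN' i ((le_max_right _ _).trans hi) j ((le_max_right _ _).trans hj)) K U hC).1⟩

theorem exists_measure_compl_closedBall_le (μ : Measure E3) [IsFiniteMeasure μ] {ε : ℝ≥0∞}
    (hε : ε ≠ 0) : ∃ R : ℝ, μ (Metric.closedBall 0 R)ᶜ ≤ ε := by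
  obtain ⟨K, hKs, hK, hlt⟩ := MeasurableSet.univ.exists_isCompact_sdiff_lt (measure_ne_top μ _) hε
  obtain ⟨R, hR⟩ := hK.isBounded.subset_closedBall (0 : E3)
  refine ⟨R, (measure_mono ?_).trans hlt.le⟩
  rw [← Set.compl_eq_univ_sdiff]
  exact Set.compl_subset_compl.2 hR

/-- No mass of a minimizing sequence escapes to infinity. -/
theorem IsMinimizing.exists_eventually_measure_compl_closedBall_le {m : ℕ} {B : FlatChain m}
    {P : ℕ → PolyChain m} (hP : IsMinimizing B P) (hB : flatMass B ≠ ⊤) {ε : ℝ≥0∞}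
    (hε : ε ≠ 0) : ∃ R : ℝ, ∀ᶠ i in atTop, (P i).measure (Metric.closedBall 0 R)ᶜ ≤ ε := by
  have hε2 : ε / 2 ≠ 0 := (ENNReal.half_pos hε).ne'
  obtain ⟨C, hC⟩ := exists_separates_cube m one_pos
  obtain ⟨δ, hδ, N, hN⟩ := hP.exists_measure_le hB C hε2
  obtain ⟨N', hN'⟩ := exists_forall_ge_flatNorm_sub_lt hP.tendsto hP.tendsto hδ
  obtain ⟨N'', hN''⟩ := eventually_atTop.1 (hP.eventually_mass_lt hB one_ne_zero)
  -- all later terms are compared with the single term `P j`, whose measure is tight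
  set j := max N' N''
  have : IsFiniteMeasure (P j).measure := ⟨(hN'' j (le_max_right _ _)).trans_le le_top⟩
  obtain ⟨R, hR⟩ := exists_measure_compl_closedBall_le (P j).measure hε2
  refine ⟨2 * (R + 1), eventually_atTop.2 ⟨max N N', fun i hi => ?_⟩⟩
  have h := (hN i ((le_max_left _ _).trans hi) (P j)
    (hN' i ((le_max_right _ _).trans hi) j (le_max_left _ _)) _ _ (hC 0 R)).2
  calc (P i).measure (Metric.closedBall 0 (2 * (R + 1)))ᶜ
      ≤ (P i).measure {x | ∀ k, |x k - (0 : E3) k| < R + 1}ᶜ := by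
        refine measure_mono (Set.compl_subset_compl.2 fun x hx => ?_)
        have hx : ∀ k, |x k - (0 : E3) k| < R + 1 := hx
        have hpos : 0 ≤ R + 1 := (abs_nonneg _).trans (hx 0).le
        rw [mem_closedBall_zero_iff, EuclideanSpace.norm_eq, Real.sqrt_le_iff]
        refine ⟨by positivity, ?_⟩
        have h2 : ∀ k, ‖x k‖ ^ 2 ≤ (R + 1) ^ 2 := fun k => by
          refine pow_le_pow_left₀ (norm_nonneg _) ?_ 2
          simpa using (hx k).le
        rw [Fin.sum_univ_three]
        nlinarith [h2 0, h2 1, h2 2]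
    _ ≤ (P j).measure {x | ∀ k, |x k - (0 : E3) k| ≤ R}ᶜ + ε / 2 := h
    _ ≤ (P j).measure (Metric.closedBall 0 R)ᶜ + ε / 2 := by
        gcongr
        intro x hx k
        have := PiLp.norm_apply_le x k
        rw [mem_closedBall_zero_iff] at hx
        simpa using this.trans hx
    _ ≤ ε / 2 + ε / 2 := by gcongr
    _ = ε := ENNReal.add_halves ε

/-! ### The mass measure of a flat chain of finite mass -/

/-- The part of the portmanteau theorem about open sets, for finite measures: the total masses
converge, so it follows from the part about closed sets by passing to complements. -/
theorem FiniteMeasure.le_liminf_measure_open_of_tendsto {Ω ι : Type*} {L : Filter ι}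
    [MeasurableSpace Ω] [TopologicalSpace Ω] [HasOuterApproxClosed Ω] [OpensMeasurableSpace Ω]
    {μ : FiniteMeasure Ω} {μs : ι → FiniteMeasure Ω} (h : Tendsto μs L (𝓝 μ)) {G : Set Ω}
    (hG : IsOpen G) : (μ : Measure Ω) G ≤ liminf (fun i => (μs i : Measure Ω) G) L := by
  refine le_of_forall_lt fun c hc => ?_
  obtain ⟨d, hcd, hd⟩ := exists_between hc
  refine hcd.trans_le (le_liminf_of_le (by isBoundedDefault) ?_)
  have hcl := FiniteMeasure.limsup_measure_closed_le_of_tendsto h hG.isClosed_compl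
  have hmass : Tendsto (fun i => (μs i : Measure Ω) Set.univ) L (𝓝 ((μ : Measure Ω) Set.univ)) := by
    have := (FiniteMeasure.continuous_mass.tendsto μ).comp h
    have := (ENNReal.continuous_coe.tendsto _).comp this
    simpa [Function.comp_def, FiniteMeasure.ennreal_mass] using this
  have hGfin : (μ : Measure Ω) Gᶜ ≠ ⊤ := measure_ne_top _ _
  obtain ⟨e, he, hde⟩ : ∃ e : ℝ≥0∞, e ≠ 0 ∧ d + (e + e) < (μ : Measure Ω) G := by
    obtain ⟨d', hd', hd''⟩ := exists_between hd
    refine ⟨(d' - d) / 2, (ENNReal.half_pos (tsub_pos_of_lt hd').ne').ne', ?_⟩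
    rwa [ENNReal.add_halves, add_tsub_cancel_of_le hd'.le]
  have hetop : e ≠ ⊤ := ne_top_of_le_ne_top ((hde.trans_le le_top).ne)
    ((le_add_self.trans le_add_self : e ≤ d + (e + e)))
  have h1 : ∀ᶠ i in L, (μs i : Measure Ω) Gᶜ < (μ : Measure Ω) Gᶜ + e :=
    eventually_lt_of_limsup_lt (hcl.trans_lt (ENNReal.lt_add_right hGfin he)) (by isBoundedDefault)
  have h2 : ∀ᶠ i in L, (μ : Measure Ω) Set.univ < (μs i : Measure Ω) Set.univ + e := by
    have ht : Tendsto (fun i => (μs i : Measure Ω) Set.univ + e) L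
        (𝓝 ((μ : Measure Ω) Set.univ + e)) := hmass.add tendsto_const_nhds
    exact ht.eventually (lt_mem_nhds (ENNReal.lt_add_right (measure_ne_top _ _) he))
  filter_upwards [h1, h2] with i hi1 hi2
  have e1 := measure_add_measure_compl (μ := (μ : Measure Ω)) hG.measurableSet
  have e2 := measure_add_measure_compl (μ := (μs i : Measure Ω)) hG.measurableSet
  have h3 : d + ((μ : Measure Ω) Gᶜ + (e + e)) ≤
      (μs i : Measure Ω) G + ((μ : Measure Ω) Gᶜ + (e + e)) := by
    calc d + ((μ : Measure Ω) Gᶜ + (e + e)) = (d + (e + e)) + (μ : Measure Ω) Gᶜ := by ring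
      _ ≤ (μ : Measure Ω) G + (μ : Measure Ω) Gᶜ := by gcongr
      _ ≤ (μs i : Measure Ω) Set.univ + e := by rw [e1]; exact hi2.le
      _ = (μs i : Measure Ω) G + (μs i : Measure Ω) Gᶜ + e := by rw [e2]
      _ ≤ (μs i : Measure Ω) G + ((μ : Measure Ω) Gᶜ + e) + e := by gcongr
      _ = _ := by ring
  exact (ENNReal.add_le_add_iff_right
    (ENNReal.add_ne_top.2 ⟨hGfin, ENNReal.add_ne_top.2 ⟨hetop, hetop⟩⟩)).1 h3

open Classical in
/-- The measure of a polyhedral chain as an element of the space of finite measures; the value is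
`0` if the mass is infinite. -/
noncomputable def PolyChain.finiteMeasure {m : ℕ} (P : PolyChain m) : FiniteMeasure E3 :=
  if h : IsFiniteMeasure P.measure then ⟨P.measure, h⟩ else 0

theorem PolyChain.toMeasure_finiteMeasure {m : ℕ} {P : PolyChain m} (h : P.mass ≠ ⊤) :
    (P.finiteMeasure : Measure E3) = P.measure := by
  have : IsFiniteMeasure P.measure := ⟨h.lt_top⟩
  exact congrArg FiniteMeasure.toMeasure
    (show P.finiteMeasure = ⟨P.measure, this⟩ from dif_pos this)

theorem IsMinimizing.eventually_toMeasure_eq {m : ℕ} {B : FlatChain m} {P : ℕ → PolyChain m}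
    (hP : IsMinimizing B P) (hB : flatMass B ≠ ⊤) :
    ∀ᶠ i in atTop, ((P i).finiteMeasure : Measure E3) = (P i).measure :=
  (hP.eventually_mass_lt hB one_ne_zero).mono fun _ h =>
    PolyChain.toMeasure_finiteMeasure (h.trans_le le_top).ne

theorem IsMinimizing.exists_forall_measure_compl_closedBall_le {m : ℕ} {B : FlatChain m}
    {P : ℕ → PolyChain m} (hP : IsMinimizing B P) (hB : flatMass B ≠ ⊤) {ε : ℝ≥0∞}
    (hε : ε ≠ 0) :
    ∃ R : ℝ, ∀ i, ((P i).finiteMeasure : Measure E3) (Metric.closedBall 0 R)ᶜ ≤ ε := by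
  obtain ⟨R₀, hR₀⟩ := hP.exists_eventually_measure_compl_closedBall_le hB hε
  obtain ⟨N, hN⟩ := eventually_atTop.1 (hR₀.and (hP.eventually_toMeasure_eq hB))
  have h : ∀ i, ∃ R : ℝ, ((P i).finiteMeasure : Measure E3) (Metric.closedBall 0 R)ᶜ ≤ ε :=
    fun i => exists_measure_compl_closedBall_le _ hε
  choose R hR using h
  obtain ⟨R', hR'⟩ := ((Finset.range N).image R).exists_le
  refine ⟨max R₀ R', fun i => ?_⟩
  rcases lt_or_ge i N with hi | hi
  · refine le_trans (measure_mono (Set.compl_subset_compl.2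
      (Metric.closedBall_subset_closedBall ?_))) (hR i)
    exact (hR' _ (Finset.mem_image_of_mem _ (Finset.mem_range.2 hi))).trans (le_max_right _ _)
  · refine le_trans (measure_mono (Set.compl_subset_compl.2
      (Metric.closedBall_subset_closedBall (le_max_left R₀ R')))) ?_
    rw [(hN i hi).2]
    exact (hN i hi).1

/-- The measures of a minimizing sequence are relatively compact, by Prokhorov's theorem. -/
theorem IsMinimizing.exists_isCompact {m : ℕ} {B : FlatChain m} {P : ℕ → PolyChain m}
    (hP : IsMinimizing B P) (hB : flatMass B ≠ ⊤) :
    ∃ S : Set (FiniteMeasure E3), IsCompact S ∧ ∀ᶠ i in atTop, (P i).finiteMeasure ∈ S := by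
  obtain ⟨u, -, hu0, hu⟩ := exists_seq_strictAnti_tendsto (0 : NNReal)
  have hR : ∀ n : ℕ, ∃ R : ℝ, ∀ i,
      ((P i).finiteMeasure : Measure E3) (Metric.closedBall 0 R)ᶜ ≤ (u n : ℝ≥0∞) := fun n =>
    hP.exists_forall_measure_compl_closedBall_le hB (ENNReal.coe_ne_zero.2 (hu0 n).ne')
  choose R hR using hR
  have hS := isCompact_setOfPred_finiteMeasure_mass_le_compl_isCompact_le
    (flatMass B + 1).toNNReal hu (fun n => isCompact_closedBall (0 : E3) (R n))
    (Or.inl inferInstance)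
  refine ⟨_, hS, ?_⟩
  filter_upwards [hP.eventually_mass_lt hB one_ne_zero, hP.eventually_toMeasure_eq hB] with i h1 h2
  have hBt : flatMass B + 1 ≠ ⊤ := ENNReal.add_ne_top.2 ⟨hB, ENNReal.one_ne_top⟩
  refine ⟨?_, fun n => ?_⟩
  · rw [← ENNReal.coe_le_coe, FiniteMeasure.ennreal_mass, h2, ENNReal.coe_toNNReal hBt]
    exact h1.le
  · rw [← ENNReal.coe_le_coe, FiniteMeasure.ennreal_coeFn_eq_coeFn_toMeasure]
    exact hR n i

/-- By the comparison principle, any limit of the measures of one minimizing sequence is at most any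
limit of those of another. Hence, by symmetry, all these limits agree. -/
theorem IsMinimizing.le_of_tendsto {m : ℕ} {B : FlatChain m} {P P' : ℕ → PolyChain m}
    (hP : IsMinimizing B P) (hP' : IsMinimizing B P') (hB : flatMass B ≠ ⊤) {L L' : Filter ℕ}
    [L.NeBot] [L'.NeBot] (hL : L ≤ atTop) (hL' : L' ≤ atTop) {ν ν' : FiniteMeasure E3}
    (hν : Tendsto (fun i => (P i).finiteMeasure) L (𝓝 ν))
    (hν' : Tendsto (fun i => (P' i).finiteMeasure) L' (𝓝 ν')) :
    (ν : Measure E3) ≤ ν' := by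
  have hcpt : ∀ K : Set E3, IsCompact K → (ν : Measure E3) K ≤ (ν' : Measure E3) K := by
    intro K hK
    refine le_of_forall_gt fun r hr => ?_
    obtain ⟨r', hr', hrr'⟩ := exists_between hr
    obtain ⟨r'', hr'', hrr''⟩ := exists_between hrr'
    -- on `K ⊆ V₁ ⊆ V₂ ⊆ U` with `ν' U < r'`, compare `P` on `closure V₁` with `P'` on `V₂`
    obtain ⟨U, hKU, hU, hUr⟩ := hK.exists_isOpen_lt_of_lt _ hr'
    obtain ⟨V₂, hV₂, hKV₂, hV₂U, hV₂c⟩ := exists_open_between_and_isCompact_closure hK hU hKU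
    obtain ⟨V₁, hV₁, hKV₁, hV₁V₂, hV₁c⟩ := exists_open_between_and_isCompact_closure hK hV₂ hKV₂
    have hle : ∀ ε : ℝ≥0∞, ε ≠ 0 → (ν : Measure E3) K ≤ r' + ε := by
      intro ε hε
      obtain ⟨N, hN⟩ := hP.exists_measure_isCompact_le hB hP'.tendsto hV₁c hV₂ hV₁V₂ hε
      have hj : ∀ᶠ j in L', (P' j).measure V₂ < r' := by
        have hlim := FiniteMeasure.limsup_measure_closed_le_of_tendsto hν'
          (isClosed_closure (s := V₂))
        have := eventually_lt_of_limsup_lt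
          (hlim.trans_lt ((measure_mono hV₂U).trans_lt hUr)) (by isBoundedDefault)
        filter_upwards [this, (hP'.eventually_toMeasure_eq hB).filter_mono hL'] with j h1 h2
        rw [h2] at h1
        exact (measure_mono subset_closure).trans_lt h1
      obtain ⟨j, hj, hjN⟩ := (hj.and ((eventually_ge_atTop N).filter_mono hL')).exists
      calc (ν : Measure E3) K ≤ (ν : Measure E3) V₁ := measure_mono hKV₁
        _ ≤ liminf (fun i => ((P i).finiteMeasure : Measure E3) V₁) L :=
            FiniteMeasure.le_liminf_measure_open_of_tendsto hν hV₁
        _ ≤ r' + ε := by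
            refine liminf_le_of_le (by isBoundedDefault) fun b hb => ?_
            obtain ⟨i, hbi, hiN, hi⟩ := (hb.and (((eventually_ge_atTop N).filter_mono hL).and
              ((hP.eventually_toMeasure_eq hB).filter_mono hL))).exists
            rw [hi] at hbi
            calc b ≤ (P i).measure V₁ := hbi
              _ ≤ (P i).measure (closure V₁) := measure_mono subset_closure
              _ ≤ (P' j).measure V₂ + ε := hN i hiN j hjN
              _ ≤ r' + ε := by gcongr
    have := hle (r'' - r') (tsub_pos_of_lt hr'').ne'
    rw [add_tsub_cancel_of_le hr''.le] at this
    exact this.trans_lt hrr''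
  refine Measure.le_iff.2 fun X hX => ENNReal.le_of_forall_pos_le_add fun ε hε _ => ?_
  obtain ⟨K, hKX, hK, hlt⟩ := hX.exists_isCompact_lt_add (measure_ne_top (ν : Measure E3) X)
    (ε := (ε : ℝ≥0∞)) (by exact_mod_cast hε.ne')
  refine hlt.le.trans ?_
  exact add_le_add ((hcpt K hK).trans (measure_mono hKX)) le_rfl

/-- The measures of all minimizing sequences converge weakly to the same measure. -/
theorem exists_forall_isMinimizing_tendsto {m : ℕ} {B : FlatChain m} (hB : flatMass B ≠ ⊤) :
    ∃ ρ : FiniteMeasure E3, ∀ P, IsMinimizing B P →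
      Tendsto (fun i => (P i).finiteMeasure) atTop (𝓝 ρ) := by
  obtain ⟨P₀, hP₀⟩ := exists_isMinimizing hB
  obtain ⟨S₀, hS₀, hev₀⟩ := hP₀.exists_isCompact hB
  obtain ⟨ρ, -, hρ⟩ := hS₀.exists_mapClusterPt_of_frequently hev₀.frequently
  obtain ⟨L₀, hL₀, hρ⟩ := mapClusterPt_iff_ultrafilter.1 hρ
  refine ⟨ρ, fun P hP => ?_⟩
  obtain ⟨S, hS, hev⟩ := hP.exists_isCompact hB
  refine hS.tendsto_nhds_of_unique_mapClusterPt hev fun ν _ hν => ?_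
  obtain ⟨L, hL, hν⟩ := mapClusterPt_iff_ultrafilter.1 hν
  refine Subtype.ext (le_antisymm ?_ ?_)
  · exact hP.le_of_tendsto hP₀ hB hL hL₀ hν hρ
  · exact hP₀.le_of_tendsto hP hB hL₀ hL hρ hν

theorem exists_isMassMeasure {m : ℕ} {B : FlatChain m} (hB : flatMass B ≠ ⊤) :
    ∃ ρ : Measure E3, IsMassMeasure B ρ := by
  obtain ⟨ρ, hρ⟩ := exists_forall_isMinimizing_tendsto hB
  refine ⟨ρ, inferInstance, fun P h1 h2 X hX hfr => ?_⟩
  have hP : IsMinimizing B P := ⟨h1, h2⟩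
  have ht := hρ P hP
  have h3 : Tendsto (fun i => ((P i).finiteMeasure : Measure E3) X) atTop
      (𝓝 ((ρ : Measure E3) X)) :=
    tendsto_measure_of_le_liminf_measure_of_limsup_measure_le interior_subset subset_closure hfr
      (FiniteMeasure.le_liminf_measure_open_of_tendsto ht isOpen_interior)
      (FiniteMeasure.limsup_measure_closed_le_of_tendsto ht isClosed_closure)
  refine h3.congr' ?_
  filter_upwards [hP.eventually_toMeasure_eq hB] with i hi
  rw [hi]

/-- The values of a mass measure on closed sets are limits of its values on thickenings with null
frontiers, and the latter are determined by any minimizing sequence. -/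
theorem IsMassMeasure.unique {m : ℕ} {B : FlatChain m} (hB : flatMass B ≠ ⊤) {ρ ρ' : Measure E3}
    (h : IsMassMeasure B ρ) (h' : IsMassMeasure B ρ') : ρ = ρ' := by
  have := h.finite
  have := h'.finite
  obtain ⟨P, hP⟩ := exists_isMinimizing hB
  have hcl : ∀ F : Set E3, IsClosed F → ρ F = ρ' F := by
    intro F hF
    obtain ⟨r, hr, hr'⟩ := exists_null_frontiers_thickening (ρ + ρ') F
    have hr0 : Tendsto r atTop (𝓝[>] 0) :=
      tendsto_nhdsWithin_iff.2 ⟨hr, Eventually.of_forall fun n => (hr' n).1⟩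
    have heq : ∀ n, ρ (Metric.thickening (r n) F) = ρ' (Metric.thickening (r n) F) := fun n => by
      have h0 := (hr' n).2
      rw [Measure.add_apply, add_eq_zero] at h0
      exact tendsto_nhds_unique
        (h.tendsto P hP.tendsto hP.tendsto_mass _ Metric.isOpen_thickening.measurableSet h0.1)
        (h'.tendsto P hP.tendsto hP.tendsto_mass _ Metric.isOpen_thickening.measurableSet h0.2)
    have t1 := (tendsto_measure_thickening_of_isClosed (μ := ρ)
      ⟨1, one_pos, measure_ne_top _ _⟩ hF).comp hr0
    have t2 := (tendsto_measure_thickening_of_isClosed (μ := ρ')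
      ⟨1, one_pos, measure_ne_top _ _⟩ hF).comp hr0
    exact tendsto_nhds_unique t1 (t2.congr fun n => (heq n).symm)
  refine ext_of_generate_finite _ ?_ isPiSystem_isClosed hcl (hcl _ isClosed_univ)
  rw [← borel_eq_generateFrom_isClosed]
  exact BorelSpace.measurable_eq

/-! ### Components of flat dipolyhedra -/

/-- If `D = Q + ∂R`, then the dipole part of `D` is the sum of the dipole part of `Q`, the mass part
of `R` and the boundary of the dipole part of `R`. -/
theorem Dipolyhedron.flatNorm_dipolePart_le {k : ℕ} (D : Dipolyhedron k) :
    (dipolePart k D).flatNorm ≤ D.flatEnergy := by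
  refine le_iInf fun Q => le_iInf fun R => le_iInf fun h => ?_
  have hD : dipolePart k D = (dipolePart k Q + massPart (k + 1) R) +
      PolyChain.boundary (k + 1) (dipolePart (k + 1) R) := by
    rw [h, map_add, boundary_apply, map_sub, dipolePart_dipole, dipolePart_massChain]
    abel
  refine (PolyChain.flatNorm_le hD).trans ?_
  calc (dipolePart k Q + massPart (k + 1) R).mass + (dipolePart (k + 1) R).mass
      ≤ ((dipolePart k Q).mass + (massPart (k + 1) R).mass) + (dipolePart (k + 1) R).mass := by
        gcongr
        exact PolyChain.mass_add _ _
    _ ≤ ((dipolePart k Q).mass + (massPart (k + 1) R).mass) + (dipolePart (k + 1) R).mass +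
        (massPart k Q).mass := le_self_add
    _ = Q.energy + R.energy := by
        unfold energy
        ring

theorem Dipolyhedron.flatNorm_massPart_le {k : ℕ} (D : Dipolyhedron k) :
    (massPart k D).flatNorm ≤ D.flatEnergy := by
  refine le_iInf fun Q => le_iInf fun R => le_iInf fun h => ?_
  have hD : massPart k D = massPart k Q + PolyChain.boundary k (-massPart (k + 1) R) := by
    rw [h, map_add, boundary_apply, map_sub, massPart_dipole, massPart_massChain, map_neg]
    abel
  refine (PolyChain.flatNorm_le hD).trans ?_
  rw [PolyChain.mass_neg]
  exact add_le_add le_add_self le_add_self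

theorem Dipolyhedron.continuous_dipolePart (k : ℕ) : Continuous (dipolePart k) := by
  have : LipschitzWith 1 (dipolePart k) := fun D D' => by
    rw [edist_eq, PolyChain.edist_eq, ← map_sub, ENNReal.coe_one, one_mul]
    exact flatNorm_dipolePart_le _
  exact this.continuous

theorem Dipolyhedron.continuous_massPart (k : ℕ) : Continuous (massPart k) := by
  have : LipschitzWith 1 (massPart k) := fun D D' => by
    rw [edist_eq, PolyChain.edist_eq, ← map_sub, ENNReal.coe_one, one_mul]
    exact flatNorm_massPart_le _
  exact this.continuous

/-- The flat chain `B` in `δ B + μ C`. -/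
noncomputable def flatDipolePart (k : ℕ) : FlatDipolyhedron k →+ FlatChain (k + 1) :=
  (Dipolyhedron.dipolePart k).completion (Dipolyhedron.continuous_dipolePart k)

/-- The flat chain `C` in `δ B + μ C`. -/
noncomputable def flatMassPart (k : ℕ) : FlatDipolyhedron k →+ FlatChain k :=
  (Dipolyhedron.massPart k).completion (Dipolyhedron.continuous_massPart k)

section Components

variable {k : ℕ}

theorem continuous_flatDipolePart : Continuous (flatDipolePart k) :=
  AddMonoidHom.continuous_completion _ _

theorem continuous_flatMassPart : Continuous (flatMassPart k) :=
  AddMonoidHom.continuous_completion _ _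

theorem continuous_delta : Continuous (delta k) := AddMonoidHom.continuous_completion _ _

theorem continuous_mu : Continuous (mu k) := AddMonoidHom.continuous_completion _ _

theorem flatDipolePart_coe (D : Dipolyhedron k) :
    flatDipolePart k D = (Dipolyhedron.dipolePart k D : FlatChain (k + 1)) :=
  AddMonoidHom.completion_coe _ _ _

theorem flatMassPart_coe (D : Dipolyhedron k) :
    flatMassPart k D = (Dipolyhedron.massPart k D : FlatChain k) :=
  AddMonoidHom.completion_coe _ _ _

theorem delta_coe (S : PolyChain (k + 1)) :
    delta k S = (Dipolyhedron.dipole k S : FlatDipolyhedron k) :=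
  AddMonoidHom.completion_coe _ _ _

theorem mu_coe (T : PolyChain k) :
    mu k T = (Dipolyhedron.massChain k T : FlatDipolyhedron k) :=
  AddMonoidHom.completion_coe _ _ _

theorem flatDipolePart_delta (B : FlatChain (k + 1)) : flatDipolePart k (delta k B) = B := by
  refine Completion.induction_on B
    (isClosed_eq (continuous_flatDipolePart.comp continuous_delta) continuous_id) fun S => ?_
  rw [delta_coe, flatDipolePart_coe, Dipolyhedron.dipolePart_dipole]

theorem flatDipolePart_mu (C : FlatChain k) : flatDipolePart k (mu k C) = 0 := by
  refine Completion.induction_on C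
    (isClosed_eq (continuous_flatDipolePart.comp continuous_mu) continuous_const) fun T => ?_
  rw [mu_coe, flatDipolePart_coe, Dipolyhedron.dipolePart_massChain, Completion.coe_zero]

theorem flatMassPart_delta (B : FlatChain (k + 1)) : flatMassPart k (delta k B) = 0 := by
  refine Completion.induction_on B
    (isClosed_eq (continuous_flatMassPart.comp continuous_delta) continuous_const) fun S => ?_
  rw [delta_coe, flatMassPart_coe, Dipolyhedron.massPart_dipole, Completion.coe_zero]

theorem flatMassPart_mu (C : FlatChain k) : flatMassPart k (mu k C) = C := by
  refine Completion.induction_on C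
    (isClosed_eq (continuous_flatMassPart.comp continuous_mu) continuous_id) fun T => ?_
  rw [mu_coe, flatMassPart_coe, Dipolyhedron.massPart_massChain]

theorem delta_add_mu (A : FlatDipolyhedron k) :
    delta k (flatDipolePart k A) + mu k (flatMassPart k A) = A := by
  refine Completion.induction_on A (isClosed_eq ((continuous_delta.comp
    continuous_flatDipolePart).add (continuous_mu.comp continuous_flatMassPart)) continuous_id)
    fun D => ?_
  rw [flatDipolePart_coe, flatMassPart_coe, delta_coe, mu_coe, ← Completion.coe_add]
  congr 1
  exact Prod.ext (add_zero _) (zero_add _)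

theorem flatDipolePart_add (B : FlatChain (k + 1)) (C : FlatChain k) :
    flatDipolePart k (delta k B + mu k C) = B := by
  rw [map_add, flatDipolePart_delta, flatDipolePart_mu, add_zero]

theorem flatMassPart_add (B : FlatChain (k + 1)) (C : FlatChain k) :
    flatMassPart k (delta k B + mu k C) = C := by
  rw [map_add, flatMassPart_delta, flatMassPart_mu, zero_add]

theorem tendsto_dipolePart {A : FlatDipolyhedron k} {D : ℕ → Dipolyhedron k}
    (h : Tendsto (fun i => (D i : FlatDipolyhedron k)) atTop (𝓝 A)) :
    Tendsto (fun i => (Dipolyhedron.dipolePart k (D i) : FlatChain (k + 1))) atTop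
      (𝓝 (flatDipolePart k A)) :=
  ((continuous_flatDipolePart.tendsto A).comp h).congr fun i => flatDipolePart_coe (D i)

theorem tendsto_massPart {A : FlatDipolyhedron k} {D : ℕ → Dipolyhedron k}
    (h : Tendsto (fun i => (D i : FlatDipolyhedron k)) atTop (𝓝 A)) :
    Tendsto (fun i => (Dipolyhedron.massPart k (D i) : FlatChain k)) atTop
      (𝓝 (flatMassPart k A)) :=
  ((continuous_flatMassPart.tendsto A).comp h).congr fun i => flatMassPart_coe (D i)

theorem flatMass_flatDipolePart_le (A : FlatDipolyhedron k) :
    flatMass (flatDipolePart k A) ≤ energy A :=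
  le_iInf₂ fun _ hD => (flatMass_le_liminf (tendsto_dipolePart hD)).trans
    (liminf_le_liminf (Eventually.of_forall fun _ => le_self_add))

theorem flatMass_flatMassPart_le (A : FlatDipolyhedron k) :
    flatMass (flatMassPart k A) ≤ energy A :=
  le_iInf₂ fun _ hD => (flatMass_le_liminf (tendsto_massPart hD)).trans
    (liminf_le_liminf (Eventually.of_forall fun _ => le_add_self))

end Components

/-! ### Supports -/

theorem PolyChain.measure_eq_zero_of_disjoint_support {m : ℕ} {P : PolyChain m} {X : Set E3}
    (h : Disjoint P.support X) : P.measure X = 0 :=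
  measure_mono_null h.subset_compl_left Measure.measure_compl_support

/-- A flat chain that is approximated by chains away from `x` has no mass near `x`. -/
theorem IsMassMeasure.notMem_support {m : ℕ} {B : FlatChain m} (hB : flatMass B ≠ ⊤)
    {ρ : Measure E3} (h : IsMassMeasure B ρ) {S : ℕ → PolyChain m}
    (hS : Tendsto (fun i => (S i : FlatChain m)) atTop (𝓝 B)) {V : Set E3} (hV : IsOpen V)
    (hSV : ∀ i, (S i).measure V = 0) {x : E3} (hx : x ∈ V) : x ∉ ρ.support := by
  have := h.finite
  obtain ⟨P, hP⟩ := exists_isMinimizing hB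
  obtain ⟨r, hr, hrV⟩ := Metric.nhds_basis_closedBall.mem_iff.1 (hV.mem_nhds hx)
  obtain ⟨s, hs, hfr⟩ := exists_null_frontier_thickening ρ {x} hr
  rw [Metric.thickening_singleton] at hfr
  have hle : ∀ ε : ℝ≥0∞, ε ≠ 0 → ρ (Metric.ball x s) ≤ ε := fun ε hε => by
    obtain ⟨N, hN⟩ := hP.exists_measure_isCompact_le hB hS (isCompact_closedBall x r) hV hrV hε
    refine le_of_tendsto
      (h.tendsto P hP.tendsto hP.tendsto_mass _ Metric.isOpen_ball.measurableSet hfr) ?_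
    filter_upwards [eventually_ge_atTop N] with i hi
    have := hN i hi N le_rfl
    rw [hSV, zero_add] at this
    exact (measure_mono (Metric.ball_subset_closedBall.trans
      (Metric.closedBall_subset_closedBall hs.2.le))).trans this
  refine Measure.notMem_support_iff_exists.2 ⟨Metric.ball x s, Metric.ball_mem_nhds x hs.1, ?_⟩
  by_contra h0
  obtain ⟨ε, hε, hlt⟩ := exists_between (pos_iff_ne_zero.2 h0)
  exact absurd (hle ε hε.ne') (not_le.2 hlt)

/-- Near the support of its mass measure, a flat chain can be approximated by polyhedral chains:
the parts of a minimizing sequence far from the support have little mass. -/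
theorem IsMassMeasure.exists_tendsto_support_subset {m : ℕ} {B : FlatChain m}
    (hB : flatMass B ≠ ⊤) {ρ : Measure E3} (h : IsMassMeasure B ρ) {U : Set E3} (hU : IsOpen U)
    (hρU : ρ.support ⊆ U) : ∃ S : ℕ → PolyChain m,
      Tendsto (fun i => (S i : FlatChain m)) atTop (𝓝 B) ∧ ∀ i, (S i).support ⊆ U := by
  have := h.finite
  obtain ⟨P, hP⟩ := exists_isMinimizing hB
  have hUc : ρ Uᶜ = 0 :=
    measure_mono_null (Set.compl_subset_compl.2 hρU) Measure.measure_compl_support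
  have key : ∀ n : ℕ, ∃ i ≥ n, ∃ S : PolyChain m,
      (S - P i).flatNorm < ((n : ℝ≥0∞) + 1)⁻¹ ∧ S.support ⊆ U := by
    intro n
    have hε : ((n : ℝ≥0∞) + 1)⁻¹ ≠ 0 := by simp
    obtain ⟨K, hKU, hK, hKlt⟩ :=
      hU.measurableSet.exists_isCompact_sdiff_lt (measure_ne_top ρ U) hε
    obtain ⟨V₂, hV₂, hKV₂, hV₂U, -⟩ := exists_open_between_and_isCompact_closure hK hU hKU
    obtain ⟨V₁, hV₁, hKV₁, hV₁V₂, hV₁c⟩ := exists_open_between_and_isCompact_closure hK hV₂ hKV₂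
    obtain ⟨C, hC⟩ := exists_separates_of_isCompact m hV₁c hV₂ hV₁V₂
    -- the part `D` of `P i` near `closure V₁` carries almost all of its mass
    have hV₁ρ : ρ V₁ᶜ < ((n : ℝ≥0∞) + 1)⁻¹ := by
      refine lt_of_le_of_lt ?_ hKlt
      calc ρ V₁ᶜ ≤ ρ ((U \ K) ∪ Uᶜ) := measure_mono fun x hx => by
            by_cases hxU : x ∈ U
            · exact Or.inl ⟨hxU, fun hxK => hx (hKV₁ hxK)⟩
            · exact Or.inr hxU
        _ ≤ ρ (U \ K) + ρ Uᶜ := measure_union_le _ _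
        _ = ρ (U \ K) := by rw [hUc, add_zero]
    have hlim := limsup_measure_closed_le_of_forall_tendsto_measure
      (μ := ρ) (μs := fun i => (P i).measure) (L := atTop)
      (fun {E} hE hfr => h.tendsto P hP.tendsto hP.tendsto_mass E hE hfr) _ hV₁.isClosed_compl
    have hev := eventually_lt_of_limsup_lt (hlim.trans_lt hV₁ρ) (by isBoundedDefault)
    obtain ⟨i, hi, hmass, hin⟩ := (hev.and ((hP.eventually_mass_lt hB one_ne_zero).and
      (eventually_ge_atTop n))).exists
    have hfin : flatMass B + 1 ≠ ⊤ := ENNReal.add_ne_top.2 ⟨hB, ENNReal.one_ne_top⟩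
    obtain ⟨W, hW, hVW, hWV, D, hD, -⟩ := hC (P i) _
      ((P i).flatNorm_le_mass.trans_lt hmass) hfin
    refine ⟨i, hin, D, ?_, ?_⟩
    · have hD0 : IsRestriction W (P i - 0) D := by rwa [sub_zero]
      have hz : (0 : PolyChain m).measure (Set.univ ∩ W) = 0 := by
        refine measure_mono_null (Set.subset_univ _) ?_
        exact PolyChain.mass_zero
      rw [← PolyChain.flatNorm_neg, neg_sub]
      refine (PolyChain.flatNorm_le_mass _).trans_lt ?_
      rw [PolyChain.mass, hD0.measure_sub hW .univ, hz, add_zero, ← Set.compl_eq_univ_sdiff]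
      exact (measure_mono (Set.compl_subset_compl.2 (subset_closure.trans hVW))).trans_lt hi
    · refine (Measure.support_subset_of_isClosed isClosed_closure ?_).trans hV₂U
      rw [mem_ae_iff, hD.measure_eq hW isClosed_closure.measurableSet.compl]
      have : (closure V₂)ᶜ ∩ W = ∅ := by
        refine Set.eq_empty_of_forall_notMem fun x hx => hx.1 (subset_closure (hWV hx.2))
      rw [this, measure_empty]
  choose i hi S hS hSU using key
  refine ⟨S, tendsto_of_flatNorm_sub (hP.tendsto.comp (tendsto_atTop_mono hi tendsto_id)) ?_, hSU⟩
  exact tendsto_of_tendsto_of_tendsto_of_le_of_le tendsto_const_nhds tendsto_inv_nat_add_one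
    (fun _ => bot_le) fun n => (hS n).le

/-- A union of closed sets that approximate the two components supports their sum; conversely, a
point off a closed set that supports the sum is off the supports of both mass measures, as the
components inherit the approximating sequence. -/
theorem isSupport_add {k : ℕ} {B : FlatChain (k + 1)} {C : FlatChain k} (hB : flatMass B ≠ ⊤)
    (hC : flatMass C ≠ ⊤) {ρB ρC : Measure E3} (hρB : IsMassMeasure B ρB)
    (hρC : IsMassMeasure C ρC) : IsSupport (ρB + ρC).support (delta k B + mu k C) := by
  rw [Measure.support_add]
  refine ⟨⟨Measure.isClosed_support.union Measure.isClosed_support, fun U hU hsub => ?_⟩, ?_⟩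
  · obtain ⟨S, hS, hSU⟩ := hρB.exists_tendsto_support_subset hB hU
      (Set.subset_union_left.trans hsub)
    obtain ⟨T, hT, hTU⟩ := hρC.exists_tendsto_support_subset hC hU
      (Set.subset_union_right.trans hsub)
    refine ⟨fun i => Dipolyhedron.dipole k (S i) + Dipolyhedron.massChain k (T i), ?_, fun i => ?_⟩
    · have h := ((continuous_delta.tendsto B).comp hS).add ((continuous_mu.tendsto C).comp hT)
      refine h.congr fun i => ?_
      rw [Completion.coe_add, ← delta_coe, ← mu_coe]
      rfl
    · simp only [Dipolyhedron.support, map_add, Dipolyhedron.dipolePart_dipole,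
        Dipolyhedron.dipolePart_massChain, Dipolyhedron.massPart_dipole,
        Dipolyhedron.massPart_massChain, add_zero, zero_add]
      exact Set.union_subset (hSU i) (hTU i)
  · rintro F ⟨hF, hsupp⟩ x hx
    by_contra hxF
    obtain ⟨r, hr, hrF⟩ := Metric.nhds_basis_closedBall.mem_iff.1 (hF.isOpen_compl.mem_nhds hxF)
    obtain ⟨D, hD, hDU⟩ := hsupp (Metric.closedBall x r)ᶜ Metric.isClosed_closedBall.isOpen_compl
      (Set.subset_compl_comm.1 hrF)
    have hdisj : ∀ i, Disjoint (D i).support (Metric.ball x r) := fun i =>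
      (Set.disjoint_left.2 fun y hy hy' => hDU i hy (Metric.ball_subset_closedBall hy'))
    have hxr : x ∈ Metric.ball x r := Metric.mem_ball_self hr
    rcases hx with hx | hx
    · have ht := tendsto_dipolePart hD
      rw [flatDipolePart_add] at ht
      exact hρB.notMem_support hB ht Metric.isOpen_ball (fun i =>
        PolyChain.measure_eq_zero_of_disjoint_support
          ((hdisj i).mono_left Set.subset_union_left)) hxr hx
    · have ht := tendsto_massPart hD
      rw [flatMassPart_add] at ht
      exact hρC.notMem_support hC ht Metric.isOpen_ball (fun i =>
        PolyChain.measure_eq_zero_of_disjoint_support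
          ((hdisj i).mono_left Set.subset_union_right)) hxr hx

end SoapFilm

theorem mainTheorem6 (k : ℕ) (A : SoapFilm.FlatDipolyhedron k) (hA : SoapFilm.energy A < ⊤) :
    (∃! ν : Measure SoapFilm.E3, SoapFilm.IsEnergyMeasure A ν) ∧
      ∀ ν : Measure SoapFilm.E3, SoapFilm.IsEnergyMeasure A ν →
        SoapFilm.IsSupport ν.support A := by
  have hB := ((SoapFilm.flatMass_flatDipolePart_le A).trans_lt hA).ne
  have hC := ((SoapFilm.flatMass_flatMassPart_le A).trans_lt hA).ne
  obtain ⟨ρB, hρB⟩ := SoapFilm.exists_isMassMeasure hB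
  obtain ⟨ρC, hρC⟩ := SoapFilm.exists_isMassMeasure hC
  have huniq : ∀ ν, SoapFilm.IsEnergyMeasure A ν → ν = ρB + ρC := by
    rintro ν ⟨B, C, ρB', ρC', hA', hB', hC', rfl⟩
    obtain rfl : SoapFilm.flatDipolePart k A = B := by rw [hA', SoapFilm.flatDipolePart_add]
    obtain rfl : SoapFilm.flatMassPart k A = C := by rw [hA', SoapFilm.flatMassPart_add]
    rw [hB'.unique hB hρB, hC'.unique hC hρC]
  refine ⟨⟨ρB + ρC, ⟨_, _, ρB, ρC, (SoapFilm.delta_add_mu A).symm, hρB, hρC, rfl⟩, huniq⟩,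
    fun ν hν => ?_⟩
  rw [huniq ν hν]
  have h := SoapFilm.isSupport_add hB hC hρB hρC
  rwa [SoapFilm.delta_add_mu] at h
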